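/- An *OE-group* is a finitely generated residually finite group with fewer than 2 ends (i.e. finite or one-ended). Let $G_1$ be an OE-group and let $H,K\le G_1$ be finite subgroups. Let $\mathrm{Iso}(H,K)$ be the set of isomorphisms $H\to K$. For $f\in\mathrm{Iso}(H,K)$ let $$\mathrm{HNN}(G_1,H,K,f,t)=\langle G_1,t\mid t\,h\,t^{-1}=f(h)\ (h\in H)\rangle$$ (the convention $t^{-1}ht=f(h)$ gives an isomorphic group, via $t\mapsto t^{-1}$). Write $\tau_g(x)=gxg^{-1}$ and $H^{g}=g^{-1}Hg$. Let $\mathrm{Aut}_{G_1}(H)=\{\alpha\in\mathrm{Aut}(G_1):\alpha(H)=H\}$ and $\Gamma_H=G_1\rtimes \mathrm{Aut}_{G_1}(H)$, a subgroup of the holomorph $G_1\rtimes\mathrm{Aut}(G_1)$. It acts on the finite subgroups $X$ of $G_1$ by $(g,\alpha)\cdot X=g\,\alpha(X)\,g^{-1}$; let $\Gamma_{HK}$ be the stabilizer of $K$ in $\Gamma_H$. The group $\Gamma_{HK}$ acts on $\mathrm{Iso}(H,K)$ by $(g,\alpha)\cdot f=\tau_g\,\alpha f\alpha^{-1}$;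 let $\widetilde\Gamma_{HK}$ be its image in $\mathrm{Sym}(\mathrm{Iso}(H,K))$. If there are $\psi\in\mathrm{Aut}(G_1)$ and $g\in G_1$ with $\psi(H)=K$ and $\psi(K)=H^{g}$, choose such a pair, define $\iota\in\mathrm{Sym}(\mathrm{Iso}(H,K))$ by $\iota(f)=\tau_{\psi^{-1}(g^{-1})}\,\psi^{-1}f^{-1}\psi$, and let $\overline\Gamma_{HK}=\langle\widetilde\Gamma_{HK},\iota\rangle=\widetilde\Gamma_{HK}\cdot\langle\iota\rangle$ (this does not depend on the choice of $(\psi,g)$). Otherwise let $\overline\Gamma_{HK}=\widetilde\Gamma_{HK}$. **Theorem.** For all $f,f_1\in\mathrm{Iso}(H,K)$, the groups $\mathrm{HNN}(G_1,H,K,f,t)$ and $\mathrm{HNN}(G_1,H,K,f_1,t_1)$ are isomorphic if and only if $f$ and $f_1$ lie in the same $\overline\Gamma_{HK}$-orbit of $\mathrm{Iso}(H,K)$. Consequently, the number of isomorphism classes of groups of the form $\mathrm{HNN}(G_1,H,K,f,t)$, with $f\in\mathrm{Iso}(H,K)$, equals the number of orbits $|\overline\Gamma_{HK}\backslash\mathrm{Iso}(H,K)|$.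 -/

import Mathlib

open scoped Pointwise

namespace HNNIso

noncomputable section

universe u

/-- An OE-group: a finitely generated residually finite group with fewer than two ends.
The number of ends of a finitely generated group is the number of ends of its Cayley graph
with respect to a finite generating set (it does not depend on that set). -/
structure IsOEGroup (G : Type u) [Group G] : Prop where
  fg : Group.FG G
  residuallyFinite : Group.ResiduallyFinite G
  ends_lt_two : ∃ S : Finset G, Subgroup.closure (S : Set G) = ⊤ ∧
    (SimpleGraph.mulCayley (S : Set G)).end.encard < 2

variable {G : Type u} [Group G]

/-- The holomorph `G ⋊ Aut(G)`. -/
abbrev Holomorph (G : Type u) [Group G] : Type u :=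
  G ⋊[MonoidHom.id (MulAut G)] MulAut G

/-- The automorphism `τ_g ∘ α : x ↦ g α(x) g⁻¹` of `G` attached to `(g, α)`. It gives the action
`(g, α) • X = g α(X) g⁻¹` of the holomorph on the subgroups of `G`. -/
def tau (G : Type u) [Group G] : Holomorph G →* MulAut G where
  toFun γ := MulAut.conj γ.left * γ.right
  map_one' := by simp
  map_mul' a b := by
    ext x
    simp [mul_assoc]

@[simp] lemma tau_apply (γ : Holomorph G) (x : G) :
    tau G γ x = γ.left * γ.right x * γ.left⁻¹ := by
  simp [tau]

/-- The isomorphism `H ≃* K` induced by an automorphism `φ` of `G` with `φ(H) = K`. -/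
def restrict (φ : MulAut G) {H K : Subgroup G} (h : φ • H = K) : H ≃* K :=
  (Subgroup.equivSMul φ H).trans (MulEquiv.subgroupCongr h)

@[simp] lemma coe_restrict (φ : MulAut G) {H K : Subgroup G} (h : φ • H = K) (x : H) :
    (restrict φ h x : G) = φ x := rfl

@[simp] lemma coe_restrict_symm (φ : MulAut G) {H K : Subgroup G} (h : φ • H = K) (x : K) :
    ((restrict φ h).symm x : G) = φ⁻¹ x := by
  obtain ⟨y, rfl⟩ := (restrict φ h).surjective x
  simp

/-- `Γ_H = G ⋊ Aut_G(H)`, where `Aut_G(H)` is the group of automorphisms of `G` leaving `H`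
invariant. -/
def GammaH (H : Subgroup G) : Subgroup (Holomorph G) :=
  (MulAction.stabilizer (MulAut G) H).comap SemidirectProduct.rightHom

/-- `Γ_{HK}`: the stabilizer of `K` in `Γ_H` for the action `(g, α) • X = g α(X) g⁻¹`. -/
def GammaHK (H K : Subgroup G) : Subgroup (Holomorph G) :=
  GammaH H ⊓ (MulAction.stabilizer (MulAut G) K).comap (tau G)

lemma map_left {H K : Subgroup G} (γ : GammaHK H K) : γ.1.right • H = H := γ.2.1

lemma map_right {H K : Subgroup G} (γ : GammaHK H K) : tau G γ.1 • K = K := γ.2.2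

/-- The action of `Γ_{HK}` on `Iso(H, K)`: `(g, α)` sends `f` to `τ_g ∘ α ∘ f ∘ α⁻¹`. -/
def actIso (H K : Subgroup G) : GammaHK H K →* Equiv.Perm (H ≃* K) where
  toFun γ :=
    { toFun := fun f => (restrict γ.1.right (map_left γ)).symm.trans
        (f.trans (restrict (tau G γ.1) (map_right γ)))
      invFun := fun f => (restrict γ.1.right (map_left γ)).trans
        (f.trans (restrict (tau G γ.1) (map_right γ)).symm)
      left_inv := fun f => by ext x; simp
      right_inv := fun f => by ext x; simp }
  map_one' := by
    ext f x
    have : (restrict ((1 : GammaHK H K) : Holomorph G).right (map_left 1)).symm x = x := by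
      ext
      rw [coe_restrict_symm]
      rfl
    change tau G ((1 : GammaHK H K) : Holomorph G) (f ((restrict _ (map_left 1)).symm x)) = f x
    rw [this, OneMemClass.coe_one, map_one]
    rfl
  map_mul' a b := by
    ext f x
    have : (restrict (a * b).1.right (map_left (a * b))).symm x =
      (restrict b.1.right (map_left b)).symm ((restrict a.1.right (map_left a)).symm x) := by
      ext
      rw [coe_restrict_symm, coe_restrict_symm, coe_restrict_symm]
      rfl
    change tau G (a * b).1 (f ((restrict _ (map_left (a * b))).symm x)) =
      tau G a.1 (tau G b.1 (f ((restrict _ (map_left b)).symm ((restrict _ (map_left a)).symm x))))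
    rw [this, Subgroup.coe_mul, map_mul]
    rfl

/-- `Γ̃_{HK}`: the image of `Γ_{HK}` in `Sym(Iso(H, K))`. -/
def GammaTilde (H K : Subgroup G) : Subgroup (Equiv.Perm (H ≃* K)) := (actIso H K).range

/-- `ψ(H) = K` and `ψ(K) = H^g = g⁻¹ H g`: the automorphism `ψ` swaps the conjugacy classes of
`H` and `K`. -/
structure IsSwap (H K : Subgroup G) (ψ : MulAut G) (g : G) : Prop where
  map_H : ψ • H = K
  map_K : ψ • K = MulAut.conj g⁻¹ • H

lemma IsSwap.back {H K : Subgroup G} {ψ : MulAut G} {g : G} (h : IsSwap H K ψ g) :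
    (MulAut.conj (ψ⁻¹ g⁻¹) * ψ⁻¹) • H = K := by
  have e : MulAut.conj (ψ⁻¹ g⁻¹) * ψ⁻¹ = ψ⁻¹ * MulAut.conj g⁻¹ := by
    ext x; simp
  rw [e, mul_smul, ← h.map_K, inv_smul_smul]

/-- The permutation `ι(f) = τ_{ψ⁻¹(g⁻¹)} ∘ ψ⁻¹ ∘ f⁻¹ ∘ ψ` of `Iso(H, K)`. -/
def iota {H K : Subgroup G} {ψ : MulAut G} {g : G} (h : IsSwap H K ψ g) :
    Equiv.Perm (H ≃* K) where
  toFun f := (restrict ψ h.map_H).trans (f.symm.trans (restrict _ h.back))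
  invFun f := (restrict _ h.back).trans (f.symm.trans (restrict ψ h.map_H))
  left_inv f := by ext x; simp
  right_inv f := by ext x; simp

open Classical in
/-- `Γ̄_{HK}`: the group generated by `Γ̃_{HK}` and `ι` if some automorphism of `G` swaps the
conjugacy classes of `H` and `K`, and `Γ̃_{HK}` otherwise. -/
def GammaBar (H K : Subgroup G) : Subgroup (Equiv.Perm (H ≃* K)) :=
  if h : ∃ p : MulAut G × G, IsSwap H K p.1 p.2 then
    GammaTilde H K ⊔ Subgroup.zpowers (iota h.choose_spec)
  else GammaTilde H K

lemma iota_mem {H K : Subgroup G} {ψ ζ : MulAut G} {g r : G}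
    (h : IsSwap H K ψ g) (k : IsSwap H K ζ r) :
    iota k ∈ GammaTilde H K ⊔ Subgroup.zpowers (iota h) := by
  have hH : (ζ⁻¹ * ψ) • H = H := by rw [mul_smul, h.map_H, ← k.map_H, inv_smul_smul]
  let γ : Holomorph G := ⟨ζ⁻¹ (r⁻¹ * g), ζ⁻¹ * ψ⟩
  have e : tau G γ * (MulAut.conj (ψ⁻¹ g⁻¹) * ψ⁻¹) = (MulAut.conj (ζ⁻¹ r⁻¹) * ζ⁻¹) * ψ * ψ⁻¹ := by
    ext x
    change ζ⁻¹ (r⁻¹ * g) * (ζ⁻¹ * ψ) ((MulAut.conj (ψ⁻¹ g⁻¹) * ψ⁻¹) x) * (ζ⁻¹ (r⁻¹ * g))⁻¹ = _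
    simp [mul_assoc]
  have hK : tau G γ • K = K := by
    conv_lhs => rw [← h.back]
    rw [← mul_smul, e, mul_inv_cancel_right, k.back]
  let γ' : GammaHK H K := ⟨γ, hH, hK⟩
  have key : iota k = actIso H K γ' * iota h := by
    ext f x
    have h1 : restrict ψ h.map_H ((restrict γ'.1.right (map_left γ')).symm x) =
        restrict ζ k.map_H x := by
      ext; simp [γ', γ]
    have h2 := DFunLike.congr_fun e ((f.symm (restrict ζ k.map_H x) : H) : G)
    rw [mul_inv_cancel_right] at h2
    change (MulAut.conj (ζ⁻¹ r⁻¹) * ζ⁻¹) (f.symm (restrict ζ k.map_H x) : H) =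
      tau G γ ((MulAut.conj (ψ⁻¹ g⁻¹) * ψ⁻¹) (f.symm (restrict ψ h.map_H
        ((restrict γ'.1.right (map_left γ')).symm x)) : H))
    rw [h1]
    exact h2.symm
  rw [key]
  exact mul_mem (Subgroup.mem_sup_left ⟨γ', rfl⟩)
    (Subgroup.mem_sup_right (Subgroup.mem_zpowers _))

/-- `Γ̄_{HK}` does not depend on the choice of the swapping automorphism. -/
lemma GammaBar_eq_of_isSwap {H K : Subgroup G} {ψ : MulAut G} {g : G} (h : IsSwap H K ψ g) :
    GammaBar H K = GammaTilde H K ⊔ Subgroup.zpowers (iota h) := by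
  have hex : ∃ p : MulAut G × G, IsSwap H K p.1 p.2 := ⟨(ψ, g), h⟩
  rw [GammaBar, dif_pos hex]
  apply le_antisymm
  · exact sup_le le_sup_left ((Subgroup.zpowers_le).2 (iota_mem h _))
  · exact sup_le le_sup_left ((Subgroup.zpowers_le).2 (iota_mem _ h))

/-- The isomorphism class of a group. -/
def isoClass (X : Type u) [Group X] :
    Quotient (CategoryTheory.isIsomorphicSetoid GrpCat.{u}) :=
  Quotient.mk _ (GrpCat.of X)

end

end HNNIso

/-! The HNN extension acts on its Bass–Serre tree with one orbit of vertices and one of edges. The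
vertex stabilizers are the conjugates of the base group; the edge stabilizers are finite of order
|H|. The tree enters only through the displacement of a base vertex, counted by stable letters
(`HNNExtension.treeLength`): the four-point inequality expresses hyperbolicity, and the degree gives
the parity.

Suppose the two HNN extensions are isomorphic. A non-elliptic element in the image of the base group
would cut that group into two infinite halves with finite boundary, giving two ends
(`two_le_encard_end_of_not_isElliptic`). So the image consists of elliptic elements and, being
finitely generated, fixes a vertex (`exists_forall_len_conj_eq_zero`). Using this in both
directions, the isomorphism can be conjugated to match the base groups
(`exists_mulEquiv_map_range`). The image s of the stable letter then generates with the base group,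
and the stabilizer of the geodesic from the base vertex v to sv has the order of an edge stabilizer.
Ping-pong forces s to move v to a neighbour (`len_eq_one_of_closure_eq_top`), so s = a t^{±1} b.
Comparing the defining relations, the exponent 1 gives an element of `GammaTilde` and the exponent
-1 gives a permutation `iota`, carrying one gluing map to the other.

Conversely, each generator of `GammaBar` is realized by an explicit isomorphism. -/

/-- An integer-valued length function on a group `G`, given by the displacement of a base vertex
for an action of `G` on a tree, with a homomorphism `deg` to `ℤ` that has the parity of the length
(so that `G` acts without inversions). -/
structure TreeLength (G : Type*) [Group G] where
  /-- The distance from the base vertex to its translate. -/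
  len : G → ℕ
  /-- The degree homomorphism. -/
  deg : G →* Multiplicative ℤ
  len_one : len 1 = 0
  len_inv : ∀ g, len g⁻¹ = len g
  four_point : ∀ x y z, len (x⁻¹ * y) + len z ≤
    max (len x + len (y⁻¹ * z)) (len y + len (x⁻¹ * z))
  exists_split : ∀ g n, len g = n + 1 → ∃ x y, g = x * y ∧ len x = 1 ∧ len y = n
  parity : ∀ g, Even ((len g : ℤ) - (deg g).toAdd)
  deg_le : ∀ g, |(deg g).toAdd| ≤ len g

/-! ### Directions at the base vertex, elliptic elements and global fixed vertices. -/

namespace TreeLength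

variable {G : Type*} [Group G] (T : TreeLength G)

attribute [simp] len_one len_inv

/-- The distance between the translates of the base vertex by `x` and by `y`. -/
def dist (x y : G) : ℕ := T.len (x⁻¹ * y)

@[simp] lemma dist_self (x : G) : T.dist x x = 0 := by simp [dist]

lemma dist_comm (x y : G) : T.dist x y = T.dist y x := by
  rw [dist, ← T.len_inv]; simp [dist]

@[simp] lemma dist_one_left (x : G) : T.dist 1 x = T.len x := by simp [dist]

@[simp] lemma dist_one_right (x : G) : T.dist x 1 = T.len x := by simp [dist]

@[simp] lemma dist_mul_left (g x y : G) : T.dist (g * x) (g * y) = T.dist x y := by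
  simp [dist, mul_assoc]

@[simp] lemma dist_self_mul (x y : G) : T.dist x (x * y) = T.len y := by simp [dist]

@[simp] lemma dist_mul_self (x y : G) : T.dist (x * y) x = T.len y := by simp [dist]

lemma dist_four_point (a b c e : G) :
    T.dist b c + T.dist a e ≤ max (T.dist a b + T.dist c e) (T.dist a c + T.dist b e) := by
  have := T.four_point (a⁻¹ * b) (a⁻¹ * c) (a⁻¹ * e)
  simpa [dist, mul_assoc] using this

lemma dist_triangle (a b c : G) : T.dist a c ≤ T.dist a b + T.dist b c := by
  have h1 := T.dist_four_point b b a c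
  have h2 := T.dist_self b
  have h3 := T.dist_comm a b
  have h4 := T.dist_four_point a a a b
  have h5 := T.dist_four_point a c b b
  have h6 := T.dist_comm b c
  have h7 := T.dist_self a
  have h8 := T.dist_four_point a b b c
  have h9 := T.dist_four_point b a c b
  omega

lemma len_mul_le (x y : G) : T.len (x * y) ≤ T.len x + T.len y := by
  simpa using T.dist_triangle 1 x (x * y)

lemma len_mul_of_len_right {h : G} (hh : T.len h = 0) (x : G) : T.len (x * h) = T.len x := by
  have h1 := T.len_mul_le x h
  have h2 := T.len_mul_le (x * h) h⁻¹
  rw [mul_inv_cancel_right, T.len_inv] at h2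
  omega

lemma len_mul_of_len_left {h : G} (hh : T.len h = 0) (x : G) : T.len (h * x) = T.len x := by
  have h1 := T.len_mul_le h x
  have h2 := T.len_mul_le h⁻¹ (h * x)
  rw [inv_mul_cancel_left, T.len_inv] at h2
  omega

lemma dist_eq_of_dist_left {x y : G} (h : T.dist x y = 0) (z : G) :
    T.dist x z = T.dist y z := by
  have h1 := T.dist_triangle x y z
  have h2 := T.dist_triangle y x z
  rw [T.dist_comm y x] at h2
  omega

lemma deg_eq_of_len {g : G} (h : T.len g = 0) : T.deg g = 1 := by
  have := T.deg_le g
  rw [h, Nat.cast_zero, abs_nonpos_iff] at this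
  exact this

/-- The stabilizer of the base vertex. -/
def base : Subgroup G where
  carrier := {g | T.len g = 0}
  one_mem' := T.len_one
  mul_mem' {a b} ha hb := by
    have := T.len_mul_le a b
    simp only [Set.mem_ofPred_eq] at *
    omega
  inv_mem' {a} ha := by simpa using ha

lemma mem_base {g : G} : g ∈ T.base ↔ T.len g = 0 := Iff.rfl

/-- The geodesics from the base vertex to its translates by `x` and by `y` have the first edge in
common. -/
def SameDir (x y : G) : Prop := T.dist x y < T.len x + T.len y

variable {T}

lemma SameDir.symm {x y : G} (h : T.SameDir x y) : T.SameDir y x := by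
  unfold SameDir at *
  rw [T.dist_comm]
  omega

/-- `SameDir` says that a Gromov product at the base vertex is positive; by the four-point
inequality (x|z) is at least the minimum of (x|y) and (y|z). -/
lemma SameDir.trans {x y z : G} (h : T.SameDir x y) (h' : T.SameDir y z) : T.SameDir x z := by
  unfold SameDir at *
  have h1 := T.dist_four_point 1 x z y
  have h2 := T.dist_comm y z
  simp only [dist_one_left] at h1
  omega

lemma SameDir.len_left {x y : G} (h : T.SameDir x y) : 0 < T.len x := by
  unfold SameDir at h
  have h1 := T.dist_triangle x 1 y
  have h2 := T.dist_triangle 1 x y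
  simp only [dist_one_left, dist_one_right] at h1 h2
  omega

lemma sameDir_refl {x : G} (h : 0 < T.len x) : T.SameDir x x := by
  simp [SameDir]; omega

lemma sameDir_of_dist {x y : G} (hx : 0 < T.len x) (h : T.dist x y = 0) : T.SameDir x y := by
  unfold SameDir; omega

lemma SameDir.mul_left {x y h : G} (hh : T.len h = 0) (hxy : T.SameDir x y) :
    T.SameDir (h * x) (h * y) := by
  simpa [SameDir, T.len_mul_of_len_left hh] using hxy

/-- Since `len (x * y)` is the distance from x⁻¹ to y, leaving in different directions means that
the product has no cancellation. -/
lemma not_sameDir_iff {x y : G} :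
    ¬ T.SameDir x⁻¹ y ↔ T.len (x * y) = T.len x + T.len y := by
  have := T.len_mul_le x y
  simp only [SameDir, dist, inv_inv, T.len_inv]
  omega

lemma sameDir_mul_right {x y : G} (hx : 0 < T.len x) (h : T.len (x * y) = T.len x + T.len y) :
    T.SameDir x (x * y) := by
  simp only [SameDir, dist_self_mul]
  omega

variable (T)

lemma len_mul_mul {x y z : G} (hxy : T.len (x * y) = T.len x + T.len y)
    (hyz : T.len (y * z) = T.len y + T.len z) (hy : 0 < T.len y) :
    T.len (x * (y * z)) = T.len x + (T.len y + T.len z) := by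
  rw [← not_sameDir_iff] at hxy
  rw [← hyz, ← not_sameDir_iff]
  exact fun h => hxy (h.trans (sameDir_mul_right hy hyz).symm)

lemma len_pow_succ {g : G} (hg : 0 < T.len g) (h : ¬ T.SameDir g⁻¹ g) (n : ℕ) :
    T.len (g ^ (n + 1)) = (n + 1) * T.len g := by
  suffices T.len (g ^ (n + 1)) = (n + 1) * T.len g ∧
      T.len (g * g ^ (n + 1)) = T.len g + T.len (g ^ (n + 1)) from this.1
  induction n with
  | zero => simpa using not_sameDir_iff.1 h
  | succ n ih =>
    rw [pow_succ' g (n + 1), T.len_mul_mul (not_sameDir_iff.1 h) ih.2 hg, ih.2, ih.1]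
    constructor <;> ring

/-- The element `g` fixes a translate of the base vertex. -/
def IsElliptic (g : G) : Prop := ∃ x, T.len (x⁻¹ * g * x) = 0

variable {T}

lemma IsElliptic.deg_eq {g : G} (h : T.IsElliptic g) : T.deg g = 1 := by
  obtain ⟨x, hx⟩ := h
  have := T.deg_eq_of_len hx
  simpa [mul_comm] using this

lemma IsElliptic.len_pow_le {g : G} (h : T.IsElliptic g) :
    ∃ C, ∀ n : ℕ, T.len (g ^ n) ≤ C := by
  obtain ⟨x, hx⟩ := h
  refine ⟨T.len x + T.len x, fun n => ?_⟩
  have h1 : g ^ n = x * (x⁻¹ * g * x) ^ n * x⁻¹ := by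
    have := conj_pow (i := n) (a := x⁻¹) (b := g)
    rw [inv_inv] at this
    rw [this]; group
  have h2 : T.len ((x⁻¹ * g * x) ^ n) = 0 := T.base.pow_mem (T.mem_base.2 hx) n
  have h3 := T.len_mul_le (x * (x⁻¹ * g * x) ^ n) x⁻¹
  rw [T.len_mul_of_len_right h2, T.len_inv] at h3
  rw [h1]
  exact h3

/-- Without back-tracking the lengths of powers grow linearly, whereas those of an elliptic element
are bounded. -/
lemma IsElliptic.sameDir {g : G} (h : T.IsElliptic g) (hg : 0 < T.len g) : T.SameDir g⁻¹ g := by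
  by_contra hs
  obtain ⟨C, hC⟩ := h.len_pow_le
  have h1 := hC (C + 1)
  rw [T.len_pow_succ hg hs] at h1
  nlinarith

/-- Conjugating `w` by the first edge of a back-tracking geodesic shortens it. -/
lemma SameDir.len_conj {w u y : G} (h : T.SameDir w⁻¹ w) (hw : w = u * y) (hu : T.len u = 1)
    (hy : T.len w = T.len y + 1) : T.len (u⁻¹ * w * u) + 2 ≤ T.len w := by
  have p1 := T.parity w
  have p2 := T.parity (w * w)
  have p3 := T.deg_le (w * w)
  have p4 := T.deg_le w
  rw [map_mul, toAdd_mul] at p2 p3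
  have h0 : T.len (w * w) < T.len w + T.len w := by
    simpa [SameDir, dist] using h
  have e1 : T.dist w 1 = T.len w := by simp
  have e2 : T.dist w (w * w) = T.len w := by simp
  have e3 : T.dist w u = T.len y := by rw [hw]; simp
  have e4 : T.dist w (w * u) = 1 := by simp [hu]
  have e5 : T.dist 1 (w * w) = T.len (w * w) := by simp
  have e6 : T.dist u 1 = 1 := by simp [hu]
  have e7 : T.dist (w * w) (w * u) = T.len y := by
    rw [dist_mul_left, hw]; simp
  have e8 : T.dist u (w * u) = T.len (u⁻¹ * w * u) := by simp [dist, mul_assoc]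
  have f1 := T.dist_four_point w u (w * u) (w * w)
  have f2 := T.dist_four_point w 1 (w * w) u
  have f3 := T.dist_four_point w u (w * w) 1
  have f4 := T.dist_comm (w * w) (w * u)
  have f5 := T.dist_comm 1 u
  have f6 := T.dist_comm 1 (w * w)
  have f7 := T.dist_comm u (w * w)
  have f8 := T.dist_comm u (w * u)
  obtain ⟨k, hk⟩ := p1
  obtain ⟨l, hl⟩ := p2
  rw [abs_le] at p3 p4
  -- If |w| = 1, parity makes the degree of w equal to ±1, so w² has degree ±2 and cannot have
  -- length below 2.
  by_cases hy0 : T.len y = 0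
  · omega
  · omega

variable (T)

/-- A conjugate of minimal length works: back-tracking would allow `SameDir.len_conj` to shorten it.
Geometrically, the base vertex is moved onto the axis. -/
lemma exists_conj_of_not_isElliptic {g : G} (hg : ¬ T.IsElliptic g) :
    ∃ x, 0 < T.len (x⁻¹ * g * x) ∧ ¬ T.SameDir (x⁻¹ * g * x)⁻¹ (x⁻¹ * g * x) := by
  obtain ⟨x, hx⟩ : ∃ x, ∀ y, T.len (x⁻¹ * g * x) ≤ T.len (y⁻¹ * g * y) := by
    obtain ⟨x, -, hx⟩ := (measure fun x => T.len (x⁻¹ * g * x)).wf.has_min Set.univ ⟨1, trivial⟩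
    exact ⟨x, fun y => not_lt.1 (hx y trivial)⟩
  have hpos : 0 < T.len (x⁻¹ * g * x) := Nat.pos_of_ne_zero fun h => hg ⟨x, h⟩
  refine ⟨x, hpos, fun hs => ?_⟩
  obtain ⟨u, y, h1, h2, h3⟩ := T.exists_split (x⁻¹ * g * x) (T.len (x⁻¹ * g * x) - 1)
    (by omega)
  have h4 := hs.len_conj h1 h2 (by omega)
  have h5 := hx (x * u)
  rw [show (x * u)⁻¹ * g * (x * u) = u⁻¹ * (x⁻¹ * g * x) * u by group] at h5
  omega

lemma even_len_of_isElliptic {g : G} (h : T.IsElliptic g) : Even (T.len g) := by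
  have := T.parity g
  rw [h.deg_eq, toAdd_one, sub_zero] at this
  exact_mod_cast this

/-- A finitely generated group of elliptic elements fixes a translate of the base vertex. -/
theorem exists_forall_len_conj_eq_zero {Γ : Subgroup G} (hfg : Γ.FG)
    (hΓ : ∀ g ∈ Γ, T.IsElliptic g) : ∃ x, ∀ g ∈ Γ, T.len (x⁻¹ * g * x) = 0 := by
  obtain ⟨S, hS⟩ := hfg
  -- Minimize the total displacement of the generators. If some generator still moves the vertex, a
  -- step along its first edge u decreases its displacement and increases no other, a contradiction.
  obtain ⟨x, hx⟩ : ∃ x, ∀ y, ∑ s ∈ S, T.len (x⁻¹ * s * x) ≤ ∑ s ∈ S, T.len (y⁻¹ * s * y) := by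
    obtain ⟨x, -, hx⟩ := (measure fun x => ∑ s ∈ S, T.len (x⁻¹ * s * x)).wf.has_min
      Set.univ ⟨1, trivial⟩
    exact ⟨x, fun y => not_lt.1 (hx y trivial)⟩
  have hSΓ : ∀ s ∈ S, s ∈ Γ := fun s hs => hS ▸ Subgroup.subset_closure hs
  have key : ∀ s ∈ S, T.len (x⁻¹ * s * x) = 0 := by
    by_contra! hne
    obtain ⟨s, hs, hs0⟩ := hne
    obtain ⟨u, y, h1, h2, h3⟩ := T.exists_split (x⁻¹ * s * x) (T.len (x⁻¹ * s * x) - 1)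
      (by omega)
    have ell : ∀ g ∈ Γ, T.IsElliptic (x⁻¹ * g * x) := fun g hg => by
      obtain ⟨z, hz⟩ := hΓ g hg
      exact ⟨x⁻¹ * z, by rw [← hz]; congr 1; group⟩
    set σ := x⁻¹ * s * x with hσ
    have hσd : T.SameDir σ⁻¹ σ := (ell s (hSΓ s hs)).sameDir (Nat.pos_of_ne_zero hs0)
    have hud : T.SameDir u σ := by
      rw [h1]; apply sameDir_mul_right (by omega); rw [← h1]; omega
    have hlt : T.len (u⁻¹ * σ * u) < T.len σ := by
      have := hσd.len_conj h1 h2 (by omega); omega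
    have hle : ∀ g ∈ S, T.len (u⁻¹ * (x⁻¹ * g * x) * u) ≤ T.len (x⁻¹ * g * x) := by
      intro g hg
      set γ := x⁻¹ * g * x with hγ
      have e8 : T.dist u (γ * u) = T.len (u⁻¹ * γ * u) := by simp [dist, mul_assoc]
      obtain ⟨k, hk⟩ : Even (T.len (u⁻¹ * γ * u)) := T.even_len_of_isElliptic (by
        obtain ⟨z, hz⟩ := ell g (hSΓ g hg)
        exact ⟨u⁻¹ * z, by rw [← hz, hγ]; congr 1; group⟩)
      obtain ⟨l, hl⟩ : Even (T.len γ) := T.even_len_of_isElliptic (ell g (hSΓ g hg))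
      by_cases hg0 : T.len γ = 0
      -- Here γ fixes the vertex. Ellipticity of γσ puts u and γu in the same direction, so their
      -- distance is below 2, hence 0 by parity.
      · have hp : T.IsElliptic (γ * σ) := by
          have := ell (g * s) (mul_mem (hSΓ g hg) (hSΓ s hs))
          rwa [show x⁻¹ * (g * s) * x = γ * σ by rw [hγ, hσ]; group] at this
        have hlp : T.len (γ * σ) = T.len σ := T.len_mul_of_len_left hg0 σ
        have d1 : T.SameDir (γ * σ)⁻¹ (γ * σ) := hp.sameDir (by omega)
        have d2 : T.SameDir (γ * u) (γ * σ) := hud.mul_left hg0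
        have d3 : T.SameDir (γ * σ)⁻¹ σ⁻¹ := by
          apply SameDir.symm
          apply sameDir_of_dist (by rw [T.len_inv]; omega)
          simp [dist, hg0]
        have d4 : T.SameDir u (γ * u) :=
          hud.trans (hσd.symm.trans (d3.symm.trans (d1.trans d2.symm)))
        have d5 : T.dist u (γ * u) < 2 := by
          unfold SameDir at d4; rwa [T.len_mul_of_len_left hg0, h2] at d4
        omega
      -- Here γ moves the vertex. If γ and σ pointed in different directions, γ⁻¹σ would not
      -- back-track, contrary to its ellipticity. So u also points towards γ, and parity absorbs the
      -- possible increase by one.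
      · have d1 : T.SameDir γ σ := by
          by_contra hc
          have hp : T.IsElliptic (γ⁻¹ * σ) := by
            have := ell (g⁻¹ * s) (mul_mem (inv_mem (hSΓ g hg)) (hSΓ s hs))
            rwa [show x⁻¹ * (g⁻¹ * s) * x = γ⁻¹ * σ by rw [hγ, hσ]; group] at this
          have hl : T.len (γ⁻¹ * σ) = T.len γ⁻¹ + T.len σ := not_sameDir_iff.1 (by rwa [inv_inv])
          have e1 : T.SameDir γ⁻¹ (γ⁻¹ * σ) := sameDir_mul_right (by rw [T.len_inv]; omega) hl
          have e2 : T.SameDir σ⁻¹ (γ⁻¹ * σ)⁻¹ := by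
            rw [mul_inv_rev γ⁻¹ σ, inv_inv]
            apply sameDir_mul_right (by rw [T.len_inv]; omega)
            rw [← T.len_inv, mul_inv_rev, inv_inv, hl, T.len_inv, T.len_inv, add_comm]
          have e3 := hp.sameDir (by omega)
          have e4 := (ell g (hSΓ g hg)).sameDir (Nat.pos_of_ne_zero hg0)
          exact hc (e4.symm.trans (e1.trans (e3.symm.trans (e2.symm.trans hσd))))
        have d2 : T.SameDir u γ := hud.trans d1.symm
        have d3 := T.dist_triangle u γ (γ * u)
        rw [dist_self_mul, e8] at d3
        unfold SameDir at d2
        omega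
    have := hx (x * u)
    refine absurd this (not_le.2 (Finset.sum_lt_sum ?_ ⟨s, hs, ?_⟩))
    · intro g hg
      rw [show (x * u)⁻¹ * g * (x * u) = u⁻¹ * (x⁻¹ * g * x) * u by group]
      exact hle g hg
    · rw [show (x * u)⁻¹ * s * (x * u) = u⁻¹ * (x⁻¹ * s * x) * u by group]
      exact hlt
  refine ⟨x, fun g hg => ?_⟩
  rw [← hS] at hg
  have hcl : Subgroup.closure (S : Set G) ≤ T.base.comap (MulAut.conj x⁻¹).toMonoidHom := by
    rw [Subgroup.closure_le]
    intro s hs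
    have := key s hs
    simpa [mem_base] using this
  have := hcl hg
  simpa [mem_base] using this

end TreeLength

/-! ### Ends of Cayley graphs and sets with finite boundary. -/

namespace SimpleGraph

variable {V : Type*} (X : SimpleGraph V)

/-- A finite set of vertices leaves only finitely many complementary components, so an ultrafilter
must choose one. -/
lemma exists_componentCompl_mem_ultrafilter [X.LocallyFinite] [Fact X.Preconnected]
    (U : Ultrafilter V) (hU : (U : Filter V) ≤ Filter.cofinite) (K : Finset V) :
    ∃ C : X.ComponentCompl K, (C : Set V) ∈ U := by
  have h : (⋃ C : X.ComponentCompl K, (C : Set V)) ∈ U := by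
    refine Filter.mem_of_superset (hU K.finite_toSet.compl_mem_cofinite) fun v hv => ?_
    exact Set.mem_iUnion.2 ⟨_, X.componentComplMk_mem hv⟩
  simpa using (Ultrafilter.finite_biUnion_mem_iff (is := Set.univ)
    (s := fun C : X.ComponentCompl K => (C : Set V)) Set.finite_univ).1 (by simpa using h)

/-- A free ultrafilter on the vertices of a connected locally finite graph converges to an end. -/
lemma exists_end_of_ultrafilter [X.LocallyFinite] [Fact X.Preconnected]
    (U : Ultrafilter V) (hU : (U : Filter V) ≤ Filter.cofinite) :
    ∃ e ∈ X.end, ∀ K : (Finset V)ᵒᵖ, ComponentCompl.supp (e K) ∈ U := by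
  choose C hC using X.exists_componentCompl_mem_ultrafilter U hU
  refine ⟨fun K => C K.unop, fun {L K} f => ?_, fun K => hC K.unop⟩
  have h : (K.unop : Set V) ⊆ L.unop := CategoryTheory.le_of_op_hom f
  change (C L.unop).hom h = C K.unop
  rw [ComponentCompl.hom_eq_iff_not_disjoint]
  intro hd
  have := Filter.inter_mem (hC L.unop) (hC K.unop)
  rw [hd.inter_eq] at this
  exact U.empty_notMem this

/-- A set of vertices with finite boundary that is neither finite nor cofinite separates
two ends. -/
theorem two_le_encard_end_of_finite_boundary [X.LocallyFinite] [Fact X.Preconnected]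
    {P : Set V} (hP : P.Infinite) (hP' : Pᶜ.Infinite) (K : Finset V)
    (hK : ∀ v w, X.Adj v w → v ∈ P → w ∉ P → v ∈ K) : 2 ≤ X.end.encard := by
  have ne : ∀ Q : Set V, Q.Infinite → ∃ U : Ultrafilter V, (U : Filter V) ≤ Filter.cofinite ∧
      Q ∈ U := by
    intro Q hQ
    have : (Filter.cofinite ⊓ Filter.principal Q).NeBot := by
      rwa [Filter.cofinite_inf_principal_neBot_iff]
    refine ⟨Ultrafilter.of (Filter.cofinite ⊓ Filter.principal Q),
      (Ultrafilter.of_le _).trans inf_le_left, ?_⟩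
    exact (Ultrafilter.of_le _).trans inf_le_right (Filter.mem_principal_self Q)
  obtain ⟨U, hU, hUP⟩ := ne P hP
  obtain ⟨W, hW, hWP⟩ := ne Pᶜ hP'
  obtain ⟨e, he, heU⟩ := X.exists_end_of_ultrafilter U hU
  obtain ⟨e', he', heW⟩ := X.exists_end_of_ultrafilter W hW
  have hne : e ≠ e' := by
    rintro rfl
    obtain ⟨v, hv, hvP⟩ := U.nonempty_of_mem (Filter.inter_mem (heU (Opposite.op K)) hUP)
    obtain ⟨w, hw, hwP⟩ := W.nonempty_of_mem (Filter.inter_mem (heW (Opposite.op K)) hWP)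
    -- Every edge leaving P has its P-endpoint in K, so membership in P is constant on the
    -- components outside K.
    let f : X.ComponentCompl (K : Set V) → Prop := ComponentCompl.lift (fun v _ => v ∈ P)
      fun v w hv hw h => propext ⟨fun h1 => by_contra fun h2 => hv (hK v w h h1 h2),
        fun h1 => by_contra fun h2 => hw (hK w v h.symm h1 h2)⟩
    obtain ⟨hvK, hv'⟩ := hv
    obtain ⟨hwK, hw'⟩ := hw
    have h1 : f (e (Opposite.op K)) := by rw [← hv']; exact hvP
    have h2 : ¬ f (e (Opposite.op K)) := by rw [← hw']; exact hwP
    exact h2 h1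
  rw [← Set.encard_pair hne]
  exact Set.encard_le_encard (Set.pair_subset he he')

lemma preconnected_mulCayley {Γ : Type*} [Group Γ] {S : Set Γ}
    (hS : Subgroup.closure S = ⊤) : (mulCayley S).Preconnected := by
  have h : ∀ g v : Γ, (mulCayley S).Reachable v (v * g) := by
    intro g
    have hg : g ∈ Subgroup.closure S := hS ▸ Subgroup.mem_top g
    induction hg using Subgroup.closure_induction with
    | mem s hs =>
      intro v
      by_cases h : v = v * s
      · rw [← h]
      · exact Adj.reachable ((mulCayley_adj' _ _ _).2 ⟨h, s, hs, Or.inl rfl⟩)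
    | one => intro v; rw [mul_one]
    | mul a b _ _ ha hb => intro v; rw [← mul_assoc]; exact (ha v).trans (hb _)
    | inv a _ ha => intro v; simpa using (ha (v * a⁻¹)).symm
  intro v w
  simpa using h (v⁻¹ * w) v

theorem two_le_encard_end_mulCayley {Γ : Type*} [Group Γ] {S : Finset Γ}
    (hS : Subgroup.closure (S : Set Γ) = ⊤) {P : Set Γ} (hP : P.Infinite) (hP' : Pᶜ.Infinite)
    (hb : ∀ s, {g | g ∈ P ∧ g * s ∉ P}.Finite) : 2 ≤ (mulCayley (S : Set Γ)).end.encard := by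
  classical
  have hadj : ∀ v w, (mulCayley (S : Set Γ)).Adj v w → ∃ s ∈ S ∪ S⁻¹, w = v * s := by
    intro v w h
    obtain ⟨-, s, hs, rfl | rfl⟩ := (mulCayley_adj' _ _ _).1 h
    · exact ⟨s, Finset.mem_union_left _ (by simpa using hs), rfl⟩
    · exact ⟨s⁻¹, Finset.mem_union_right _ (by simpa using hs), by simp⟩
  have : (mulCayley (S : Set Γ)).LocallyFinite := fun v => by
    refine Set.Finite.fintype (Set.Finite.subset ((S ∪ S⁻¹).image (v * ·)).finite_toSet ?_)
    intro w hw
    obtain ⟨s, hs, rfl⟩ := hadj v w hw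
    exact Finset.mem_coe.2 (Finset.mem_image_of_mem _ hs)
  have : Fact (mulCayley (S : Set Γ)).Preconnected := ⟨preconnected_mulCayley hS⟩
  have hfin : (⋃ s ∈ S ∪ S⁻¹, {g | g ∈ P ∧ g * s ∉ P}).Finite :=
    (S ∪ S⁻¹).finite_toSet.biUnion fun s _ => hb s
  refine two_le_encard_end_of_finite_boundary _ hP hP' hfin.toFinset fun v w h hv hw => ?_
  obtain ⟨s, hs, rfl⟩ := hadj v w h
  rw [Set.Finite.mem_toFinset, Set.mem_iUnion₂]
  exact ⟨s, hs, hv, hw⟩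

end SimpleGraph

/-! ### Non-elliptic elements produce two ends. -/

namespace TreeLength

variable {G : Type*} [Group G] (T : TreeLength G)

/-- The stabilizer of the geodesic from the base vertex to its translate by `x`. -/
def fixer (x : G) : Subgroup G := T.base ⊓ T.base.map (MulAut.conj x).toMonoidHom

lemma mem_fixer {x g : G} : g ∈ T.fixer x ↔ T.len g = 0 ∧ T.len (x⁻¹ * g * x) = 0 := by
  simp only [fixer, Subgroup.mem_inf, Subgroup.mem_map, mem_base]
  refine and_congr_right fun _ => ⟨?_, fun h => ⟨_, h, by simp [mul_assoc]⟩⟩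
  rintro ⟨k, hk, rfl⟩
  simpa [mul_assoc] using hk

lemma even_dist_add (x y : G) : Even (T.dist x y + (T.len x + T.len y)) := by
  have h1 := T.parity (x⁻¹ * y)
  have h2 := T.parity x
  have h3 := T.parity y
  rw [map_mul, map_inv, toAdd_mul, toAdd_inv] at h1
  rw [dist]
  grind

/-- If g is beyond the edge [1,u] and gs is not, the geodesic from g to gs crosses that edge.
Translating by g⁻¹ places the edge at one of finitely many positions on the geodesic from 1 to s.
Two g with the same position differ by an element of the finite stabilizer of [1,u]. -/
lemma finite_boundary {Γ : Type*} [Group Γ] (j : Γ →* G) (hj : Function.Injective j)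
    {u : G} (hu : T.len u = 1) (hfin : (T.fixer u : Set G).Finite) (s : Γ) :
    {g | T.SameDir u (j g) ∧ ¬ T.SameDir u (j (g * s))}.Finite := by
  have hlen : ∀ g, T.SameDir u (j g) → ¬ T.SameDir u (j (g * s)) →
      T.len (j s) = T.len (j g) + T.len (j (g * s)) := by
    intro g h1 h2
    have h3 : ¬ T.SameDir (j g) (j (g * s)) := fun h => h2 (h1.trans h)
    have h4 := T.dist_triangle (j g) 1 (j (g * s))
    rw [dist_one_left, dist_one_right] at h4
    rw [SameDir, map_mul, dist_self_mul, ← map_mul] at h3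
    rw [map_mul, dist_self_mul, ← map_mul] at h4
    omega
  have hsub : {g | T.SameDir u (j g) ∧ ¬ T.SameDir u (j (g * s))} ⊆
      ⋃ n ∈ Set.Iic (T.len (j s)), {g | T.SameDir u (j g) ∧ ¬ T.SameDir u (j (g * s)) ∧
        T.len (j g) = n} := by
    rintro g ⟨h1, h2⟩
    refine Set.mem_biUnion (x := T.len (j g)) ?_ ⟨h1, h2, rfl⟩
    have := hlen g h1 h2
    rw [Set.mem_Iic]
    omega
  refine Set.Finite.subset ((Set.finite_Iic _).biUnion fun n _ => ?_) hsub
  rcases Set.eq_empty_or_nonempty {g | T.SameDir u (j g) ∧ ¬ T.SameDir u (j (g * s)) ∧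
        T.len (j g) = n} with h | ⟨g₀, h1, h2, h3⟩
  · rw [h]; exact Set.finite_empty
  refine Set.Finite.subset (Set.Finite.preimage (f := fun g => j (g * g₀⁻¹))
    (fun a _ b _ h => by simpa using hj h) hfin) ?_
  rintro g ⟨k1, k2, k3⟩
  have key : ∀ g, T.SameDir u (j g) → ¬ T.SameDir u (j (g * s)) → T.len (j g) = n →
      T.dist 1 (j g)⁻¹ = n ∧ T.dist (j g)⁻¹ (j s) + n = T.len (j s) ∧
      T.dist 1 ((j g)⁻¹ * u) + 1 = n ∧ T.dist ((j g)⁻¹ * u) (j s) + n = T.len (j s) + 1 := by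
    intro g h1 h2 h3
    have e1 := hlen g h1 h2
    have e2 : T.dist (j g)⁻¹ (j s) = T.len (j (g * s)) := by simp [dist]
    have e3 : T.dist 1 ((j g)⁻¹ * u) = T.dist u (j g) := by rw [T.dist_comm u]; simp [dist]
    have e4 : T.dist ((j g)⁻¹ * u) (j s) = T.dist u (j (g * s)) := by simp [dist, mul_assoc]
    have e5 := T.dist_triangle 1 u (j g)
    have e6 := T.dist_triangle u 1 (j (g * s))
    obtain ⟨k, hk⟩ := T.even_dist_add u (j g)
    rw [dist_one_left, dist_one_left] at e5
    rw [dist_one_left, dist_one_right] at e6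
    unfold SameDir at h1 h2
    refine ⟨by simp [h3], by omega, by omega, by omega⟩
  obtain ⟨a1, a2, a3, a4⟩ := key g k1 k2 k3
  obtain ⟨b1, b2, b3, b4⟩ := key g₀ h1 h2 h3
  -- Two points of one geodesic at the same distance from its origin coincide; this is applied to
  -- both endpoints of the translated edges.
  have c1 := T.dist_four_point 1 (j g)⁻¹ (j g₀)⁻¹ (j s)
  have c2 := T.dist_four_point 1 ((j g)⁻¹ * u) ((j g₀)⁻¹ * u) (j s)
  rw [dist_one_left (x := j s)] at c1 c2
  refine (T.mem_fixer).2 ⟨?_, ?_⟩ <;> beta_reduce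
  · have : T.len (j (g * g₀⁻¹)) = T.dist (j g)⁻¹ (j g₀)⁻¹ := by simp [dist]
    omega
  · have : T.len (u⁻¹ * j (g * g₀⁻¹) * u) = T.dist ((j g)⁻¹ * u) ((j g₀)⁻¹ * u) := by
      simp [dist, mul_assoc]
    omega

/-- A subgroup containing a non-elliptic element has at least two ends if the stabilizers of
edges are finite. -/
theorem two_le_encard_end_of_not_isElliptic {Γ : Type*} [Group Γ] {S : Finset Γ}
    (hS : Subgroup.closure (S : Set Γ) = ⊤) (j : Γ →* G) (hj : Function.Injective j)
    (hfin : ∀ u, T.len u = 1 → (T.fixer u : Set G).Finite) {γ : Γ}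
    (hγ : ¬ T.IsElliptic (j γ)) :
    2 ≤ (SimpleGraph.mulCayley (S : Set Γ)).end.encard := by
  -- With the base vertex on the axis, the half-tree beyond the first edge u contains all positive
  -- powers and no negative ones; both families are infinite.
  obtain ⟨x, hpos, hx⟩ := T.exists_conj_of_not_isElliptic hγ
  let i : Γ →* G := (MulAut.conj x⁻¹).toMonoidHom.comp j
  have hi : Function.Injective i := (MulAut.conj x⁻¹).injective.comp hj
  have hiγ : i γ = x⁻¹ * j γ * x := by simp [i]
  rw [← hiγ] at hpos hx
  obtain ⟨u, y, h1, h2, h3⟩ := T.exists_split (i γ) (T.len (i γ) - 1) (by omega)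
  have hu : T.SameDir u (i γ) := by
    rw [h1]; apply sameDir_mul_right (by omega); rw [← h1]; omega
  have hpow : ∀ n, T.len (i γ ^ (n + 1)) = (n + 1) * T.len (i γ) := T.len_pow_succ hpos hx
  have hdir : ∀ n, T.SameDir u (i (γ ^ (n + 1))) := by
    intro n
    refine hu.trans ?_
    rw [map_pow, SameDir, pow_succ' (i γ) n, dist_self_mul, ← pow_succ', hpow]
    rcases n with _ | n
    · simpa using hpos
    · rw [hpow]; nlinarith
  have hdir' : ∀ n, ¬ T.SameDir u (i (γ⁻¹ ^ (n + 1))) := by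
    intro n hn
    refine hx (SameDir.trans (SameDir.symm ?_) (hn.symm.trans hu))
    rw [map_pow, map_inv, SameDir, dist_comm, pow_succ' (i γ)⁻¹ n, dist_self_mul, ← pow_succ',
      inv_pow, inv_pow, T.len_inv, T.len_inv, T.len_inv, hpow]
    rcases n with _ | n
    · simpa using hpos
    · rw [hpow]; nlinarith
  have hinj : ∀ δ : Γ, (∀ n, T.len (i (δ ^ (n + 1))) = (n + 1) * T.len (i γ)) →
      Function.Injective fun n : ℕ => δ ^ (n + 1) := by
    intro δ hδ m n hmn
    have h : δ ^ (m + 1) = δ ^ (n + 1) := hmn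
    have := hδ m
    rw [h, hδ n] at this
    have := Nat.eq_of_mul_eq_mul_right hpos this
    omega
  refine SimpleGraph.two_le_encard_end_mulCayley hS (P := {g | T.SameDir u (i g)}) ?_ ?_
    (T.finite_boundary i hi h2 (hfin u h2))
  · exact (Set.infinite_range_of_injective (hinj γ fun n => by rw [map_pow, hpow])).mono
      (Set.range_subset_iff.2 hdir)
  · exact (Set.infinite_range_of_injective (hinj γ⁻¹ fun n => by
      rw [map_pow, map_inv, inv_pow, T.len_inv, hpow])).mono (Set.range_subset_iff.2 hdir')

end TreeLength

/-! ### Ping-pong and the displacement of a generator. -/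

namespace TreeLength

variable {G : Type*} [Group G] (T : TreeLength G)

lemma len_prod_of_isChain {Y : Set G} (hY : ∀ y ∈ Y, 2 ≤ T.len y) (L : List G) (x : G)
    (h : (x :: L).IsChain fun a b => a ∈ Y ∧ b ∈ Y ∧ T.len (a * b) = T.len a + T.len b) :
    T.len (x :: L).prod = T.len x + T.len L.prod := by
  induction L generalizing x with
  | nil => simp
  | cons y L ih =>
    rw [List.isChain_cons_cons] at h
    have h1 := ih y h.2
    have h2 := hY y h.1.2.1
    rw [List.prod_cons] at h1
    rw [List.prod_cons, List.prod_cons, h1]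
    exact T.len_mul_mul h.1.2.2 h1 (by omega)

/-- A ping-pong criterion: if the elements of `Y` have length at least two and two of them cancel
only when their product is short or in `Y`, then no element generated by `Y` and the stabilizer of
the base vertex has length one. -/
theorem len_ne_one_of_mem_closure {Y : Set G} (hY : ∀ y ∈ Y, 2 ≤ T.len y)
    (hinv : ∀ y ∈ Y, y⁻¹ ∈ Y) (hl : ∀ a ∈ T.base, ∀ y ∈ Y, a * y ∈ Y)
    (hr : ∀ a ∈ T.base, ∀ y ∈ Y, y * a ∈ Y)
    (hmul : ∀ x ∈ Y, ∀ y ∈ Y, T.len (x * y) ≠ T.len x + T.len y → x * y ∈ T.base ∨ x * y ∈ Y)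
    {g : G} (hg : g ∈ Subgroup.closure ((T.base : Set G) ∪ Y)) : T.len g ≠ 1 := by
  -- Induction on the number of factors. If no neighbours cancel, lengths add up and each factor
  -- contributes at least 2; otherwise two neighbours merge into a single admissible factor.
  have key : ∀ n, ∀ L : List G, L.length = n → (∀ x ∈ L, x ∈ (T.base : Set G) ∪ Y) →
      T.len L.prod ≠ 1 := by
    intro n
    induction n using Nat.strong_induction_on with
    | _ n ih =>
      intro L hL hLY
      by_cases hc : L.IsChain fun a b => a ∈ Y ∧ b ∈ Y ∧ T.len (a * b) = T.len a + T.len b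
      · match L, hc, hLY with
        | [], _, _ => simp
        | [x], _, hLY =>
          have h1 : T.len x = 0 ∨ x ∈ Y := hLY x (by simp)
          rw [List.prod_singleton]
          rcases h1 with h | h
          · omega
          · have := hY x h; omega
        | x :: y :: L, hc, _ =>
          rw [T.len_prod_of_isChain hY _ _ hc]
          rw [List.isChain_cons_cons] at hc
          have := hY x hc.1.1
          omega
      · rw [List.isChain_iff_forall_rel_of_append_cons_cons] at hc
        push Not at hc
        obtain ⟨a, b, L₁, L₂, rfl, hab⟩ := hc
        have hmem : a * b ∈ (T.base : Set G) ∪ Y := by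
          rcases hLY a (by simp) with h1 | h1 <;> rcases hLY b (by simp) with h2 | h2
          · exact Or.inl (mul_mem (S := Subgroup G) h1 h2)
          · exact Or.inr (hl a h1 b h2)
          · exact Or.inr (hr b h2 a h1)
          · exact hmul a h1 b h2 (hab h1 h2)
        have := ih _ (by rw [← hL]; simp) (L₁ ++ (a * b) :: L₂) rfl (by
          intro x hx
          simp only [List.mem_append, List.mem_cons] at hx
          rcases hx with hx | rfl | hx
          · exact hLY x (by simp [hx])
          · exact hmem
          · exact hLY x (by simp [hx]))
        simpa [mul_assoc] using this
  rw [← Subgroup.mem_toSubmonoid, Subgroup.closure_toSubmonoid] at hg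
  obtain ⟨L, hL, rfl⟩ := Submonoid.exists_list_of_mem_closure hg
  refine key _ L rfl fun x hx => ?_
  rcases hL x hx with h | h | h
  · exact h
  · exact Or.inl (by simpa using inv_mem (S := Subgroup G) h)
  · exact Or.inr (by simpa using hinv _ h)

lemma exists_first_edge {s : G} (hs : 0 < T.len s) : ∃ u, T.len u = 1 ∧ T.SameDir u s := by
  obtain ⟨u, y, h1, h2, h3⟩ := T.exists_split s (T.len s - 1) (by omega)
  refine ⟨u, h2, ?_⟩
  rw [h1]; apply sameDir_mul_right (by omega); rw [← h1]; omega

variable {T}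

/-- The distances from u and from 1 to s differ by exactly one, by parity, and the common direction
decides the sign. -/
lemma SameDir.len_eq {u s : G} (hu : T.len u = 1) (h : T.SameDir u s) :
    T.len s = T.len u + T.len (u⁻¹ * s) := by
  have h1 := T.even_dist_add u s
  have h2 := T.dist_triangle 1 u s
  unfold SameDir at h
  rw [dist_one_left, dist_one_left] at h2
  change _ = _ + T.dist u s
  grind

/-- The vertex x lies on the geodesic from 1 to xy, and an element fixing both ends fixes it. -/
lemma fixer_le_of_len_mul {x y : G} (h : T.len (x * y) = T.len x + T.len y) :
    T.fixer (x * y) ≤ T.fixer x := by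
  intro g hg
  rw [mem_fixer] at hg ⊢
  refine ⟨hg.1, ?_⟩
  have h1 := T.dist_four_point 1 x (g * x) (x * y)
  have h2 : T.dist (x * y) (g * (x * y)) = 0 := by rw [← hg.2, dist]; simp [mul_assoc]
  have h3 := T.dist_eq_of_dist_left h2 (g * x)
  rw [dist_mul_left, dist_mul_self] at h3
  have h4 := T.dist_comm (x * y) (g * x)
  have h5 := T.len_mul_of_len_left hg.1 x
  have h6 : T.dist x (g * x) = T.len (x⁻¹ * g * x) := by simp [dist, mul_assoc]
  rw [dist_one_left, dist_one_left, dist_one_left, dist_self_mul] at h1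
  omega

lemma fixer_mul_of_mem_base (s : G) {h : G} (hh : h ∈ T.base) : T.fixer (s * h) = T.fixer s := by
  ext g
  rw [mem_fixer, mem_fixer, mul_inv_rev,
    show h⁻¹ * s⁻¹ * g * (s * h) = h⁻¹ * (s⁻¹ * g * s) * h by group,
    T.len_mul_of_len_right hh, T.len_mul_of_len_left (inv_mem hh)]

lemma conj_mem_fixer_inv {s g : G} (hg : g ∈ T.fixer s) : s⁻¹ * g * s ∈ T.fixer s⁻¹ := by
  rw [mem_fixer] at hg ⊢
  refine ⟨hg.2, ?_⟩
  rw [← hg.1]; congr 1; group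

lemma card_fixer_inv (s : G) : Nat.card (T.fixer s⁻¹) = Nat.card (T.fixer s) := by
  refine (Nat.card_congr ⟨fun g => ⟨s⁻¹ * g * s, conj_mem_fixer_inv g.2⟩,
    fun g => ⟨s * g * s⁻¹, by simpa using conj_mem_fixer_inv g.2⟩, fun g => ?_, fun g => ?_⟩).symm
  · ext; simp; group
  · ext; simp; group

variable {N : ℕ} (hN : ∀ u, T.len u = 1 → Finite (T.fixer u) ∧ Nat.card (T.fixer u) = N)
include hN

/-- The stabilizer of the geodesic is contained in that of its first edge, and both have order N. -/
lemma fixer_eq_of_sameDir {u s : G} (hu : T.len u = 1) (h : T.SameDir u s)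
    (hs : Nat.card (T.fixer s) = N) : T.fixer s = T.fixer u := by
  have := (hN u hu).1
  refine Subgroup.eq_of_le_of_card_ge ?_ (by rw [hs, (hN u hu).2])
  have h1 := h.len_eq hu
  conv_lhs => rw [← mul_inv_cancel_left u s]
  exact fixer_le_of_len_mul (by rwa [mul_inv_cancel_left])

lemma mem_fixer_of_sameDir {s h : G} (hs : Nat.card (T.fixer s) = N) (hh : h ∈ T.base)
    (hd : T.SameDir s (h * s)) : h ∈ T.fixer s := by
  obtain ⟨u, hu, hus⟩ := T.exists_first_edge hd.len_left
  rw [fixer_eq_of_sameDir hN hu hus hs, mem_fixer]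
  refine ⟨hh, ?_⟩
  have h1 : T.SameDir u (h * u) := hus.trans (hd.trans (hus.mul_left hh).symm)
  have h2 := T.even_dist_add u (h * u)
  rw [T.len_mul_of_len_left hh, hu] at h2
  rw [SameDir, T.len_mul_of_len_left hh, hu] at h1
  have h3 : T.dist u (h * u) = T.len (u⁻¹ * h * u) := by simp [dist, mul_assoc]
  obtain ⟨k, hk⟩ := h2
  omega

omit hN in
-- A nontrivial degree makes s hyperbolic, with translation length τ = |s²| - |s|. If this were not
-- positive, all powers would have length at most |s|, against the linear growth of their degree.
lemma len_pow_add {s : G} (hs : T.deg s ≠ 1) :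
    ∃ τ, 0 < τ ∧ ∀ n : ℕ, T.len (s ^ (n + 1)) = T.len s + n * τ := by
  have h2 : T.len s < T.len (s ^ 2) := by
    by_contra hle
    have hb : ∀ n : ℕ, T.len (s ^ (n + 1)) ≤ T.len s ∧ T.len (s ^ (n + 2)) ≤ T.len s := by
      intro n
      induction n with
      | zero => simpa using hle
      | succ n ih =>
        refine ⟨ih.2, ?_⟩
        have h1 := T.dist_four_point 1 s (s ^ 2) (s ^ (n + 3))
        have e1 : T.dist s (s ^ 2) = T.len s := by rw [pow_two, dist_self_mul]
        have e2 : T.dist (s ^ 2) (s ^ (n + 3)) = T.len (s ^ (n + 1)) := by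
          rw [show n + 3 = 2 + (n + 1) by ring, pow_add s 2, dist_self_mul]
        have e3 : T.dist s (s ^ (n + 3)) = T.len (s ^ (n + 2)) := by
          rw [pow_succ' s (n + 2), dist_self_mul]
        rw [dist_one_left, dist_one_left, dist_one_left] at h1
        rw [show n + 1 + 2 = n + 3 by ring]
        omega
    have h1 := T.deg_le (s ^ (T.len s + 1))
    have h3 := (hb (T.len s)).1
    have h4 : 0 < |(T.deg s).toAdd| := abs_pos.2 fun h => hs (toAdd_eq_zero.1 h)
    rw [map_pow, toAdd_pow, nsmul_eq_mul, abs_mul, Nat.abs_cast] at h1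
    push_cast at h1
    nlinarith
  refine ⟨T.len (s ^ 2) - T.len s, by omega, fun n => ?_⟩
  set τ := T.len (s ^ 2) - T.len s with hτ
  suffices T.len (s ^ (n + 1)) = T.len s + n * τ ∧
    T.len (s ^ (n + 2)) = T.len s + (n + 1) * τ from this.1
  induction n with
  | zero => exact ⟨by simp, by simp ; omega⟩
  | succ n ih =>
    refine ⟨by rw [ih.2], ?_⟩
    have h1 := T.dist_four_point 1 s (s ^ (n + 2)) (s ^ (n + 3))
    have h1' := T.dist_four_point 1 s (s ^ (n + 3)) (s ^ (n + 2))
    have h1'' := T.dist_four_point 1 (s ^ (n + 2)) (s ^ (n + 3)) s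
    have e1 : T.dist s (s ^ (n + 2)) = T.len (s ^ (n + 1)) := by
      rw [pow_succ' s (n + 1), dist_self_mul]
    have e2 : T.dist (s ^ (n + 2)) (s ^ (n + 3)) = T.len s := by
      rw [pow_succ s (n + 2), dist_self_mul]
    have e3 : T.dist s (s ^ (n + 3)) = T.len (s ^ (n + 2)) := by
      rw [pow_succ' s (n + 2), dist_self_mul]
    have e4 := T.dist_comm s (s ^ (n + 2))
    have e5 := T.dist_comm s (s ^ (n + 3))
    have e6 := T.dist_comm (s ^ (n + 3)) (s ^ (n + 2))
    rw [dist_one_left, dist_one_left, dist_one_left] at h1 h1' h1''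
    rw [show n + 1 + 2 = n + 3 by ring]
    have e7 : (n + 1) * τ = n * τ + τ := by ring
    have e8 : (n + 1 + 1) * τ = n * τ + τ + τ := by ring
    have e9 : 0 ≤ n * τ := Nat.zero_le _
    rw [e7] at ih
    rw [e8]
    omega

omit hN in
lemma sameDir_zpow {s : G} (hs : T.deg s ≠ 1) (hd : T.SameDir s s⁻¹) {k : ℤ} (hk : k ≠ 0) :
    T.SameDir s (s ^ k) ∧ T.len s ≤ T.len (s ^ k) := by
  have pos : ∀ r : G, T.deg r ≠ 1 → 0 < T.len r → ∀ n : ℕ,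
      T.SameDir r (r ^ (n + 1)) ∧ T.len r ≤ T.len (r ^ (n + 1)) := by
    intro r hr hr0 n
    obtain ⟨τ, hτ, h⟩ := len_pow_add hr
    refine ⟨?_, by rw [h]; omega⟩
    rcases n with _ | n
    · simpa using sameDir_refl hr0
    · rw [SameDir, pow_succ' r (n + 1), dist_self_mul, ← pow_succ' r (n + 1), h, h]
      nlinarith
  have h0 := hd.len_left
  obtain ⟨n, rfl | rfl⟩ := k.eq_nat_or_neg
  · obtain ⟨m, rfl⟩ := Nat.exists_eq_succ_of_ne_zero (by simpa using hk)
    rw [zpow_natCast]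
    exact pos s hs h0 m
  · obtain ⟨m, rfl⟩ := Nat.exists_eq_succ_of_ne_zero (by simpa using hk)
    have h1 := pos s⁻¹ (by simpa using hs) (by simpa using h0) m
    rw [zpow_neg, zpow_natCast, ← inv_pow]
    exact ⟨hd.trans h1.1, by simpa using h1.2⟩

/-- The case of an element whose axis does not pass through the base vertex. -/
lemma len_ne_one_of_sameDir {s : G} (hs : Nat.card (T.fixer s) = N) (hdeg : T.deg s ≠ 1)
    (hlen : 2 ≤ T.len s) (hd : T.SameDir s s⁻¹) {g : G}
    (hg : g ∈ Subgroup.closure ((T.base : Set G) ∪ {s})) : T.len g ≠ 1 := by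
  let Y : Set G := {y | ∃ a ∈ T.base, ∃ b ∈ T.base, ∃ k : ℤ, k ≠ 0 ∧ y = a * s ^ k * b}
  have hsY : s ∈ Y := ⟨1, one_mem _, 1, one_mem _, 1, one_ne_zero, by simp⟩
  have hlenY : ∀ a ∈ T.base, ∀ b ∈ T.base, ∀ x, T.len (a * x * b) = T.len x := by
    intro a ha b hb x
    rw [T.len_mul_of_len_right hb, T.len_mul_of_len_left ha]
  -- The geodesics to s and to s⁻¹ share their first edge, and each has the same stabilizer as that
  -- edge. Hence s normalizes this stabilizer.
  have hfix : T.fixer s⁻¹ = T.fixer s := by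
    obtain ⟨u, hu, hus⟩ := T.exists_first_edge hd.len_left
    rw [fixer_eq_of_sameDir hN hu hus hs,
      fixer_eq_of_sameDir hN hu (hus.trans hd) (by rw [card_fixer_inv, hs])]
  have hnorm : s⁻¹ ∈ Subgroup.normalizer (T.fixer s : Set G) := by
    rw [Subgroup.mem_normalizer_iff]
    intro h
    rw [inv_inv]
    refine ⟨fun hh => hfix ▸ conj_mem_fixer_inv hh, fun hh => ?_⟩
    have := conj_mem_fixer_inv (hfix.symm ▸ hh : s⁻¹ * h * s ∈ T.fixer s⁻¹)
    simpa [mul_assoc] using this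
  have hconj : ∀ k : ℤ, ∀ h ∈ T.fixer s, s ^ (-k) * h * s ^ k ∈ T.base := by
    intro k h hh
    have h1 := (Subgroup.mem_normalizer_iff.1 (zpow_mem hnorm k) h).1 hh
    rw [inv_zpow, inv_inv, ← zpow_neg] at h1
    exact h1.1
  refine T.len_ne_one_of_mem_closure (Y := Y) ?_ ?_ ?_ ?_ ?_
    (Subgroup.closure_mono (Set.union_subset_union_right _ (by simpa using hsY)) hg)
  · rintro _ ⟨a, ha, b, hb, k, hk, rfl⟩
    rw [hlenY a ha b hb]
    exact hlen.trans (sameDir_zpow hdeg hd hk).2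
  · rintro _ ⟨a, ha, b, hb, k, hk, rfl⟩
    exact ⟨b⁻¹, inv_mem hb, a⁻¹, inv_mem ha, -k, neg_ne_zero.2 hk, by simp [mul_assoc]⟩
  · rintro c hc _ ⟨a, ha, b, hb, k, hk, rfl⟩
    exact ⟨c * a, mul_mem hc ha, b, hb, k, hk, by simp [mul_assoc]⟩
  · rintro c hc _ ⟨a, ha, b, hb, k, hk, rfl⟩
    exact ⟨a, ha, b * c, mul_mem hb hc, k, hk, by simp [mul_assoc]⟩
  · rintro _ ⟨a, ha, b, hb, k, hk, rfl⟩ _ ⟨a', ha', b', hb', k', hk', rfl⟩ hne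
    -- All nonzero powers of s start along the same edge, so cancellation forces ba' to fix it. Then
    -- ba' can be moved across s^k' and the two powers merge.
    have hd1 : T.SameDir (s ^ (-k)) ((b * a') * s ^ k') := by
      by_contra h
      rw [zpow_neg, not_sameDir_iff, T.len_mul_of_len_left (mul_mem hb ha')] at h
      rw [hlenY a ha b hb, hlenY a' ha' b' hb',
        show a * s ^ k * b * (a' * s ^ k' * b') = a * (s ^ k * (b * a' * s ^ k')) * b' by group,
        hlenY a ha b' hb'] at hne
      exact hne h
    have hd2 : T.SameDir s ((b * a') * s) :=
      (sameDir_zpow hdeg hd (neg_ne_zero.2 hk)).1.trans (hd1.trans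
        ((sameDir_zpow hdeg hd hk').1.mul_left (mul_mem hb ha')).symm)
    have hmem := hconj k' _ (mem_fixer_of_sameDir hN hs (mul_mem hb ha') hd2)
    have e : a * s ^ k * b * (a' * s ^ k' * b') =
        a * s ^ (k + k') * ((s ^ (-k') * (b * a') * s ^ k') * b') := by
      group
    rw [e]
    by_cases h0 : k + k' = 0
    · left
      rw [h0, zpow_zero, mul_one]
      exact mul_mem ha (mul_mem hmem hb')
    · exact Or.inr ⟨a, ha, _, mul_mem hmem hb', _, h0, rfl⟩

/-- If the stabilizer of the base vertex and `s` generate `G`, and the stabilizer of the geodesic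
from the base vertex to its translate by `s` is as large as that of an edge, then `s` moves the
base vertex to a neighbour. -/
theorem len_eq_one_of_closure_eq_top {s : G} (hs : Nat.card (T.fixer s) = N)
    (hgen : Subgroup.closure ((T.base : Set G) ∪ {s}) = ⊤) {t : G} (ht : T.len t = 1) :
    T.len s = 1 := by
  -- Otherwise the degree would vanish on a generating set, but t has odd degree.
  have hdeg : T.deg s ≠ 1 := by
    intro h
    have hle : Subgroup.closure ((T.base : Set G) ∪ {s}) ≤ T.deg.ker := by
      rw [Subgroup.closure_le]
      rintro x (hx | rfl)
      · exact T.deg_eq_of_len hx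
      · exact h
    rw [hgen] at hle
    have h1 : T.deg t = 1 := hle (Subgroup.mem_top t)
    have h2 := T.parity t
    rw [h1, ht] at h2
    simp at h2
  by_contra hne
  have hlen : 2 ≤ T.len s := by
    have : T.len s ≠ 0 := fun h => hdeg (T.deg_eq_of_len h)
    omega
  -- If such an h exists, replacing s by sh⁻¹ keeps the generated subgroup and reduces to an axis
  -- missing the base vertex.
  by_cases hex : ∃ h ∈ T.base, T.SameDir s (h * s⁻¹)
  · obtain ⟨h, hh, hd⟩ := hex
    have hh' : T.len h⁻¹ = 0 := inv_mem hh
    have hl : T.len (s * h⁻¹) = T.len s := T.len_mul_of_len_right hh' s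
    refine len_ne_one_of_sameDir hN (s := s * h⁻¹) ?_ ?_ (by rwa [hl]) ?_ (g := t) ?_ ht
    · rwa [fixer_mul_of_mem_base s (inv_mem hh)]
    · rwa [map_mul, T.deg_eq_of_len hh', mul_one]
    · rw [mul_inv_rev, inv_inv]
      exact (sameDir_of_dist (by omega) (by simpa using T.mem_base.1 hh)).trans hd
    · have : Subgroup.closure ((T.base : Set G) ∪ {s}) ≤
          Subgroup.closure ((T.base : Set G) ∪ {s * h⁻¹}) := by
        rw [Subgroup.closure_le]
        rintro x (hx | rfl)
        · exact Subgroup.subset_closure (Or.inl hx)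
        · have h1 : x * h⁻¹ ∈ Subgroup.closure ((T.base : Set G) ∪ {x * h⁻¹}) :=
            Subgroup.subset_closure (Or.inr rfl)
          have h2 : h ∈ Subgroup.closure ((T.base : Set G) ∪ {x * h⁻¹}) :=
            Subgroup.subset_closure (Or.inl hh)
          simpa using mul_mem h1 h2
      rw [hgen] at this
      exact this (Subgroup.mem_top t)
  · push Not at hex
    -- Now s and s⁻¹ point in directions inequivalent under the base stabilizer. Equal exponents
    -- never cancel, and opposite ones cancel only to an element of that stabilizer.
    let Y : Set G := {y | ∃ a ∈ T.base, ∃ b ∈ T.base, y = a * s * b ∨ y = a * s⁻¹ * b}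
    have hlenY : ∀ a ∈ T.base, ∀ b ∈ T.base, ∀ x, T.len (a * x * b) = T.len x := by
      intro a ha b hb x
      rw [T.len_mul_of_len_right hb, T.len_mul_of_len_left ha]
    have hsY : s ∈ Y := ⟨1, one_mem _, 1, one_mem _, by simp⟩
    have hred : ∀ a ∈ T.base, ∀ b ∈ T.base, ∀ a' ∈ T.base, ∀ b' ∈ T.base, ∀ x y,
        T.len (a * x * b * (a' * y * b')) ≠ T.len (a * x * b) + T.len (a' * y * b') →
        T.SameDir x⁻¹ ((b * a') * y) := by
      intro a ha b hb a' ha' b' hb' x y hne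
      by_contra h
      rw [not_sameDir_iff, T.len_mul_of_len_left (mul_mem hb ha')] at h
      rw [hlenY a ha b hb, hlenY a' ha' b' hb',
        show a * x * b * (a' * y * b') = a * (x * (b * a' * y)) * b' by group,
        hlenY a ha b' hb'] at hne
      exact hne h
    refine T.len_ne_one_of_mem_closure (Y := Y) (g := t) ?_ ?_ ?_ ?_ ?_
      (Subgroup.closure_mono (Set.union_subset_union_right _ (by simpa using hsY))
        (hgen ▸ Subgroup.mem_top t)) ht
    · rintro _ ⟨a, ha, b, hb, rfl | rfl⟩
      · rwa [hlenY a ha b hb]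
      · rwa [hlenY a ha b hb, T.len_inv]
    · rintro _ ⟨a, ha, b, hb, rfl | rfl⟩
      · exact ⟨b⁻¹, inv_mem hb, a⁻¹, inv_mem ha, by simp [mul_assoc]⟩
      · exact ⟨b⁻¹, inv_mem hb, a⁻¹, inv_mem ha, by simp [mul_assoc]⟩
    · rintro c hc _ ⟨a, ha, b, hb, h⟩
      exact ⟨c * a, mul_mem hc ha, b, hb, by rcases h with rfl | rfl <;> simp [mul_assoc]⟩
    · rintro c hc _ ⟨a, ha, b, hb, h⟩
      exact ⟨a, ha, b * c, mul_mem hb hc, by rcases h with rfl | rfl <;> simp [mul_assoc]⟩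
    · rintro _ ⟨a, ha, b, hb, rfl | rfl⟩ _ ⟨a', ha', b', hb', rfl | rfl⟩ hne
      · have h1 := hred a ha b hb a' ha' b' hb' _ _ hne
        have h2 := h1.mul_left (inv_mem (mul_mem hb ha'))
        rw [inv_mul_cancel_left] at h2
        exact absurd h2.symm (hex _ (inv_mem (mul_mem hb ha')))
      · have h1 := hred a ha b hb a' ha' b' hb' _ _ hne
        have h2 := mem_fixer_of_sameDir hN (by rw [card_fixer_inv, hs]) (mul_mem hb ha') h1
        left
        rw [show a * s * b * (a' * s⁻¹ * b') = a * (s⁻¹⁻¹ * (b * a') * s⁻¹) * b' by group]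
        exact mul_mem (mul_mem ha (conj_mem_fixer_inv h2).1) hb'
      · have h1 := hred a ha b hb a' ha' b' hb' _ _ hne
        rw [inv_inv] at h1
        have h2 := mem_fixer_of_sameDir hN hs (mul_mem hb ha') h1
        left
        rw [show a * s⁻¹ * b * (a' * s * b') = a * (s⁻¹ * (b * a') * s) * b' by group]
        exact mul_mem (mul_mem ha (conj_mem_fixer_inv h2).1) hb'
      · have h1 := hred a ha b hb a' ha' b' hb' _ _ hne
        rw [inv_inv] at h1
        exact absurd h1 (hex _ (mul_mem hb ha'))

end TreeLength

/-! ### The length function of an HNN extension. -/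

namespace HNNExtension

open NormalWord

variable {G : Type*} [Group G] {A B : Subgroup G} {φ : A ≃* B}

/-- The number of stable letters in the normal form of an element of an HNN extension. -/
noncomputable def len (x : HNNExtension G A B φ) : ℕ :=
  (x • (empty : NormalWord (Classical.arbitrary (TransversalPair G A B)))).toList.length

lemma len_of_mul (g : G) (x : HNNExtension G A B φ) : len (of g * x) = len x := by
  rw [len, mul_smul, of_smul_eq_smul, group_smul_toList, len]

lemma len_one : len (1 : HNNExtension G A B φ) = 0 := by
  rw [len, one_smul]; rfl

lemma len_of (g : G) : len (of g : HNNExtension G A B φ) = 0 := by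
  rw [← mul_one (of g), len_of_mul, len_one]

lemma len_t_zpow_mul_of_not_cancels {u : ℤˣ} {x : HNNExtension G A B φ}
    (h : ¬ Cancels u
      (x • (empty : NormalWord (Classical.arbitrary (TransversalPair G A B))))) :
    len (t ^ (u : ℤ) * x) = len x + 1 := by
  rw [len, mul_smul, t_pow_smul_eq_unitsSMul, unitsSMul, dif_neg h]
  rfl

lemma len_of_cancels {u : ℤˣ} {x : HNNExtension G A B φ}
    (h : Cancels u (x • (empty : NormalWord (Classical.arbitrary (TransversalPair G A B))))) :
    len x = len (t ^ (u : ℤ) * x) + 1 := by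
  have h1 : ¬ Cancels (-u) ((t ^ (u : ℤ) * x) •
      (empty : NormalWord (Classical.arbitrary (TransversalPair G A B)))) := by
    rw [mul_smul, t_pow_smul_eq_unitsSMul, unitsSMul_cancels_iff]
    exact not_not.2 h
  rw [← len_t_zpow_mul_of_not_cancels h1]
  simp

/-- The elements of the form `a t b` or `a t⁻¹ b` with `a` and `b` in the base group. -/
def IsEdge (x : HNNExtension G A B φ) : Prop :=
  ∃ (a b : G) (u : ℤˣ), x = of a * t ^ (u : ℤ) * of b

lemma IsEdge.inv {x : HNNExtension G A B φ} (h : IsEdge x) : IsEdge x⁻¹ := by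
  obtain ⟨a, b, u, rfl⟩ := h
  exact ⟨b⁻¹, a⁻¹, -u, by simp [mul_assoc]⟩

lemma IsEdge.mul_of {x : HNNExtension G A B φ} (h : IsEdge x) (g : G) : IsEdge (x * of g) := by
  obtain ⟨a, b, u, rfl⟩ := h
  exact ⟨a, b * g, u, by simp [mul_assoc]⟩

lemma IsEdge.len_mul_le {e : HNNExtension G A B φ} (h : IsEdge e) (x : HNNExtension G A B φ) :
    len (e * x) ≤ len x + 1 := by
  obtain ⟨a, b, u, rfl⟩ := h
  rw [mul_assoc, mul_assoc, len_of_mul, ← len_of_mul b x]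
  by_cases hc : Cancels u ((of b * x : HNNExtension G A B φ) •
      (empty : NormalWord (Classical.arbitrary (TransversalPair G A B))))
  · have := len_of_cancels hc; omega
  · exact (len_t_zpow_mul_of_not_cancels hc).le

lemma conj_mem_range_of_mem_toSubgroup {u : ℤˣ} {g : G} (hg : g ∈ toSubgroup A B u) :
    (t ^ (u : ℤ) * of g * t ^ ((-u : ℤˣ) : ℤ) : HNNExtension G A B φ) ∈ of.range := by
  rcases Int.units_eq_one_or u with rfl | rfl
  · exact ⟨φ ⟨g, hg⟩, by rw [equiv_eq_conj]; simp⟩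
  · exact ⟨φ.symm ⟨g, hg⟩, by rw [equiv_symm_eq_conj]; simp⟩

/-- Britton's lemma for two stable letters: otherwise the word is reduced and not in the base group.
-/
lemma mem_toSubgroup_of_mem_range {u v : ℤˣ} {g : G}
    (h : (t ^ (u : ℤ) * of g * t ^ (v : ℤ) : HNNExtension G A B φ) ∈ of.range) :
    g ∈ toSubgroup A B u ∧ u ≠ v := by
  by_contra hne
  let w : ReducedWord G A B := ⟨1, [(u, g), (v, 1)], by
    rw [List.isChain_cons_cons]
    refine ⟨fun h1 => ?_, List.isChain_singleton _⟩
    by_contra h2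
    exact hne ⟨h1, h2⟩⟩
  have := ReducedWord.toList_eq_nil_of_mem_of_range φ w
    (by simpa [w, ReducedWord.prod, mul_assoc] using h)
  simp [w] at this

/-- The normal form of fx begins with the letter of f, up to an associated subgroup, so e can cancel
against it only if ef is already in the base group. -/
lemma IsEdge.len_mul_mul {e f x : HNNExtension G A B φ} (he : IsEdge e) (hf : IsEdge f)
    (hef : e * f ∉ (of : G →* HNNExtension G A B φ).range) (h : len (f * x) = len x + 1) :
    len (e * (f * x)) = len (f * x) + 1 := by
  obtain ⟨c, d, v, rfl⟩ := he
  obtain ⟨a, b, u, rfl⟩ := hf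
  have h1 : ¬ Cancels u ((of b * x : HNNExtension G A B φ) •
      (empty : NormalWord (Classical.arbitrary (TransversalPair G A B)))) := by
    intro hc
    have := len_of_cancels hc
    rw [mul_assoc, mul_assoc, len_of_mul] at h
    rw [len_of_mul] at this
    omega
  rw [← unitsSMul_cancels_iff φ, ← t_pow_smul_eq_unitsSMul, ← mul_smul] at h1
  have h2 : ¬ Cancels v ((of (d * a) * (t ^ (u : ℤ) * (of b * x)) : HNNExtension G A B φ) •
      (empty : NormalWord (Classical.arbitrary (TransversalPair G A B)))) := by
    rw [mul_smul, of_smul_eq_smul]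
    rintro ⟨k1, k2⟩
    rw [group_smul_head] at k1
    rw [group_smul_toList, h1.2, neg_neg, Option.some_inj] at k2
    subst k2
    have h3 := h1.1
    rw [neg_neg] at h3
    rw [Subgroup.mul_mem_cancel_right _ h3] at k1
    apply hef
    have h4 := conj_mem_range_of_mem_toSubgroup (φ := φ) k1
    rw [show of c * t ^ (v : ℤ) * of d * (of a * t ^ ((-v : ℤˣ) : ℤ) * of b) =
      of c * (t ^ (v : ℤ) * of (d * a) * t ^ ((-v : ℤˣ) : ℤ)) * (of b : HNNExtension G A B φ) by
        simp [mul_assoc]]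
    exact mul_mem (mul_mem ⟨c, rfl⟩ h4) ⟨b, rfl⟩
  have h3 := len_t_zpow_mul_of_not_cancels h2
  have e1 : of c * t ^ (v : ℤ) * of d * (of a * t ^ (u : ℤ) * of b * x) =
    of c * (t ^ (v : ℤ) * (of (d * a) * (t ^ (u : ℤ) * (of b * x)))) := by simp [mul_assoc]
  have e2 : of a * t ^ (u : ℤ) * of b * x = of a * (t ^ (u : ℤ) * (of b * x)) := by
    simp [mul_assoc]
  rw [e1, e2, len_of_mul, h3, len_of_mul, len_of_mul]

/-- A list of edges without cancellation between consecutive ones. -/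
def IsReduced (L : List (HNNExtension G A B φ)) : Prop :=
  (∀ e ∈ L, IsEdge e) ∧ L.IsChain fun e f => e * f ∉ (of : G →* HNNExtension G A B φ).range

lemma IsReduced.tail {e : HNNExtension G A B φ} {L : List (HNNExtension G A B φ)}
    (h : IsReduced (e :: L)) : IsReduced L :=
  ⟨fun f hf => h.1 f (List.mem_cons_of_mem _ hf), h.2.tail⟩

lemma IsReduced.len_prod_mul_of {L : List (HNNExtension G A B φ)} (h : IsReduced L) (g : G) :
    len (L.prod * of g) = L.length := by
  -- The tail is carried along because `IsEdge.len_mul_mul` needs to know that the next edge added a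
  -- letter.
  suffices len (L.prod * of g) = L.length ∧ len (L.tail.prod * of g) = L.tail.length from this.1
  induction L with
  | nil => simp [len_of]
  | cons e L ih =>
    have ih := ih h.tail
    refine ⟨?_, ih.1⟩
    cases L with
    | nil =>
      obtain ⟨a, b, u, he⟩ := h.1 e (by simp)
      have h1 : ¬ Cancels u ((of (b * g) : HNNExtension G A B φ) •
          (empty : NormalWord (Classical.arbitrary (TransversalPair G A B)))) := by
        rw [of_smul_eq_smul]
        rintro ⟨-, k2⟩
        simp at k2
      have h2 := len_t_zpow_mul_of_not_cancels h1
      rw [List.prod_singleton, he, show of a * t ^ (u : ℤ) * of b * of g =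
        of a * (t ^ (u : ℤ) * (of (b * g) : HNNExtension G A B φ)) by simp [mul_assoc],
        len_of_mul, h2, len_of]
      simp
    | cons f L =>
      rw [List.tail_cons, List.prod_cons, mul_assoc, List.length_cons] at ih
      rw [List.prod_cons, List.prod_cons, mul_assoc, mul_assoc,
        (h.1 e (by simp)).len_mul_mul (h.1 f (by simp)) (List.isChain_cons_cons.1 h.2).1
          (by rw [ih.1, ih.2]), ih.1]
      simp

lemma IsReduced.reverse_inv {L : List (HNNExtension G A B φ)} (h : IsReduced L) :
    IsReduced (L.map (·⁻¹)).reverse := by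
  refine ⟨fun e he => ?_, ?_⟩
  · simp only [List.mem_reverse, List.mem_map] at he
    obtain ⟨f, hf, rfl⟩ := he
    exact (h.1 f hf).inv
  · rw [List.isChain_reverse, List.isChain_map]
    refine h.2.imp fun a b hab hba => hab ?_
    rw [← mul_inv_rev] at hba
    exact inv_mem_iff.1 hba

lemma IsReduced.append {e f : HNNExtension G A B φ} {L M : List (HNNExtension G A B φ)}
    (hL : IsReduced (e :: L)) (hM : IsReduced (f :: M))
    (hef : e⁻¹ * f ∉ (of : G →* HNNExtension G A B φ).range) :
    IsReduced (((e :: L).map (·⁻¹)).reverse ++ f :: M) := by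
  refine ⟨fun x hx => ?_, ?_⟩
  · rcases List.mem_append.1 hx with h | h
    · exact hL.reverse_inv.1 x h
    · exact hM.1 x h
  · rw [List.isChain_append]
    refine ⟨hL.reverse_inv.2, hM.2, fun x hx y hy => ?_⟩
    simp only [List.map_cons, List.reverse_cons, List.getLast?_append, List.getLast?_singleton,
      Option.some_or, List.head?_cons, Option.mem_def,
      Option.some_inj] at hx hy
    subst hx hy
    exact hef

lemma exists_isReduced (x : HNNExtension G A B φ) :
    ∃ L g, IsReduced L ∧ x = L.prod * of g := by
  -- Normal words have their base factor on the left; using x⁻¹ and inverting puts it on the right.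
  let w : NormalWord (Classical.arbitrary (TransversalPair G A B)) := x⁻¹ • empty
  have hw : w.prod φ = x⁻¹ := by simp [w]
  have hred : IsReduced
      (w.toList.map fun a => (t ^ (a.1 : ℤ) * of a.2 : HNNExtension G A B φ)) := by
    refine ⟨fun e he => ?_, ?_⟩
    · obtain ⟨a, -, rfl⟩ := List.mem_map.1 he
      exact ⟨1, a.2, a.1, by simp⟩
    · rw [List.isChain_map]
      refine w.chain.imp fun a b hab hmem => ?_
      have h1 := mul_mem hmem (⟨b.2⁻¹, rfl⟩ : of b.2⁻¹ ∈ (of : G →* HNNExtension G A B φ).range)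
      rw [map_inv, ← mul_assoc, mul_inv_cancel_right] at h1
      have h2 := mem_toSubgroup_of_mem_range h1
      exact h2.2 (hab h2.1)
  refine ⟨_, w.head⁻¹, hred.reverse_inv, ?_⟩
  rw [← List.prod_inv_reverse, map_inv, ← mul_inv_rev]
  exact inv_eq_iff_eq_inv.1 hw.symm

lemma len_mul_of (x : HNNExtension G A B φ) (g : G) : len (x * of g) = len x := by
  obtain ⟨L, a, hL, rfl⟩ := exists_isReduced x
  rw [mul_assoc, ← map_mul, hL.len_prod_mul_of, hL.len_prod_mul_of]

lemma len_inv (x : HNNExtension G A B φ) : len x⁻¹ = len x := by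
  obtain ⟨L, a, hL, rfl⟩ := exists_isReduced x
  rw [hL.len_prod_mul_of, mul_inv_rev, ← map_inv, len_of_mul, List.prod_inv_reverse,
    ← mul_one (List.prod _), ← map_one of, hL.reverse_inv.len_prod_mul_of]
  simp

lemma len_mul_le (x y : HNNExtension G A B φ) : len (x * y) ≤ len x + len y := by
  obtain ⟨L, a, hL, rfl⟩ := exists_isReduced x
  rw [hL.len_prod_mul_of]
  induction L with
  | nil => simp [len_of_mul]
  | cons e L ih =>
    have h1 := ih hL.tail
    have h2 := (hL.1 e (by simp)).len_mul_le (L.prod * of a * y)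
    rw [List.prod_cons, mul_assoc, mul_assoc, ← mul_assoc L.prod, List.length_cons]
    omega

lemma len_eq_zero_iff {x : HNNExtension G A B φ} :
    len x = 0 ↔ x ∈ (of : G →* HNNExtension G A B φ).range := by
  constructor
  · obtain ⟨L, a, hL, rfl⟩ := exists_isReduced x
    rw [hL.len_prod_mul_of, List.length_eq_zero_iff]
    rintro rfl
    exact ⟨a, by simp⟩
  · rintro ⟨a, rfl⟩
    exact len_of a

lemma IsEdge.len_eq {e : HNNExtension G A B φ} (h : IsEdge e) : len e = 1 := by
  have : IsReduced [e] := ⟨by simpa using h, List.isChain_singleton _⟩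
  simpa using this.len_prod_mul_of 1

lemma isEdge_of_len_eq_one {x : HNNExtension G A B φ} (h : len x = 1) : IsEdge x := by
  obtain ⟨L, a, hL, rfl⟩ := exists_isReduced x
  rw [hL.len_prod_mul_of, List.length_eq_one_iff] at h
  obtain ⟨e, rfl⟩ := h
  simpa using (hL.1 e (by simp)).mul_of a

lemma len_inv_mul_of_isReduced {e f : HNNExtension G A B φ} {L M : List (HNNExtension G A B φ)}
    (hL : IsReduced (e :: L)) (hM : IsReduced (f :: M)) (a b : G)
    (hef : e⁻¹ * f ∉ (of : G →* HNNExtension G A B φ).range) :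
    len (((e :: L).prod * of a)⁻¹ * ((f :: M).prod * of b)) =
      len ((e :: L).prod * of a) + len ((f :: M).prod * of b) := by
  rw [hL.len_prod_mul_of, hM.len_prod_mul_of, mul_inv_rev, ← map_inv, mul_assoc, len_of_mul,
    List.prod_inv_reverse, ← mul_assoc, ← List.prod_append, (hL.append hM hef).len_prod_mul_of]
  simp
  omega

/-- Compare the first edges of reduced forms. If all three lead to the same neighbour, strip that
edge and induct on `len x`; otherwise pairs with different first edges have additive distance, and
the triangle inequality covers the rest. -/
lemma len_four_point (x y z : HNNExtension G A B φ) :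
    len (x⁻¹ * y) + len z ≤ max (len x + len (y⁻¹ * z)) (len y + len (x⁻¹ * z)) := by
  obtain ⟨n, hn⟩ : ∃ n, len x = n := ⟨_, rfl⟩
  induction n generalizing x y z with
  | zero =>
    obtain ⟨a, rfl⟩ := len_eq_zero_iff.1 hn
    rw [← map_inv, len_of_mul, len_of_mul]
    omega
  | succ n ih =>
    have txy := len_mul_le x⁻¹ y
    rw [len_inv] at txy
    obtain ⟨L, a, hL, hx⟩ := exists_isReduced x
    obtain ⟨M, b, hM, hy⟩ := exists_isReduced y
    obtain ⟨K, c, hK, hz⟩ := exists_isReduced z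
    match L, hL, hx, M, hM, hy, K, hK, hz with
    | [], hL, hx, _, _, _, _, _, _ =>
      rw [hx, hL.len_prod_mul_of] at hn
      simp at hn
    | _, _, _, [], _, hy, _, _, _ =>
      rw [List.prod_nil, one_mul] at hy
      rw [hy, len_mul_of, len_inv, ← map_inv, len_of_mul]
      exact le_max_left _ _
    | _, _, _, _, _, _, [], _, hz =>
      rw [List.prod_nil, one_mul] at hz
      rw [hz, len_of, len_mul_of, len_mul_of, len_inv, len_inv]
      omega
    | e :: L, hL, hx, f :: M, hM, hy, g :: K, hK, hz =>
      have rxy := len_inv_mul_of_isReduced hL hM a b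
      have rxz := len_inv_mul_of_isReduced hL hK a c
      have ryz := len_inv_mul_of_isReduced hM hK b c
      rw [← hx, ← hy] at rxy
      rw [← hx, ← hz] at rxz
      rw [← hy, ← hz] at ryz
      by_cases h1 : e⁻¹ * f ∈ (of : G →* HNNExtension G A B φ).range
      · by_cases h2 : e⁻¹ * g ∈ (of : G →* HNNExtension G A B φ).range
        · obtain ⟨p, hp⟩ := h1
          obtain ⟨q, hq⟩ := h2
          have lx : len x = len (L.prod * of a) + 1 := by
            rw [hx, hL.len_prod_mul_of, hL.tail.len_prod_mul_of, List.length_cons]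
          have ly : len y = len (of p * (M.prod * of b)) + 1 := by
            rw [hy, len_of_mul, hM.len_prod_mul_of, hM.tail.len_prod_mul_of, List.length_cons]
          have lz : len z = len (of q * (K.prod * of c)) + 1 := by
            rw [hz, len_of_mul, hK.len_prod_mul_of, hK.tail.len_prod_mul_of, List.length_cons]
          have hx' : x = e * (L.prod * of a) := by rw [hx, List.prod_cons, mul_assoc]
          have hy' : y = e * (of p * (M.prod * of b)) := by
            rw [hy, hp, List.prod_cons]; group
          have hz' : z = e * (of q * (K.prod * of c)) := by
            rw [hz, hq, List.prod_cons]; group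
          have h := ih (L.prod * of a) (of p * (M.prod * of b)) (of q * (K.prod * of c))
            (by omega)
          have exy : x⁻¹ * y = (L.prod * of a)⁻¹ * (of p * (M.prod * of b)) := by
            rw [hx', hy', mul_inv_rev, mul_assoc, inv_mul_cancel_left]
          have exz : x⁻¹ * z = (L.prod * of a)⁻¹ * (of q * (K.prod * of c)) := by
            rw [hx', hz', mul_inv_rev, mul_assoc, inv_mul_cancel_left]
          have eyz : y⁻¹ * z = (of p * (M.prod * of b))⁻¹ * (of q * (K.prod * of c)) := by
            rw [hy', hz', mul_inv_rev, mul_assoc, inv_mul_cancel_left]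
          rw [exy, exz, eyz]
          omega
        · have h3 : f⁻¹ * g ∉ (of : G →* HNNExtension G A B φ).range := fun h3 => h2 (by
            simpa [mul_assoc] using mul_mem h1 h3)
          have := ryz h3
          have := rxz h2
          omega
      · have k1 := rxy h1
        by_cases h2 : e⁻¹ * g ∈ (of : G →* HNNExtension G A B φ).range
        · have h3 : f⁻¹ * g ∉ (of : G →* HNNExtension G A B φ).range := fun h3 => h1 (by
            simpa [mul_assoc] using mul_mem h2 (inv_mem h3))
          have := ryz h3
          omega
        · have := rxz h2
          omega

/-- The homomorphism to `ℤ` counting the stable letters with sign. -/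
def deg : HNNExtension G A B φ →* Multiplicative ℤ :=
  lift 1 (Multiplicative.ofAdd 1) (by simp)

lemma IsEdge.deg_eq {e : HNNExtension G A B φ} (h : IsEdge e) :
    (deg e).toAdd = 1 ∨ (deg e).toAdd = -1 := by
  obtain ⟨a, b, u, rfl⟩ := h
  rcases Int.units_eq_one_or u with rfl | rfl <;> simp [deg]

/-- Each edge of a reduced form adds 1 to the length and ±1 to the degree. -/
lemma deg_parity_and_le (x : HNNExtension G A B φ) :
    Even ((len x : ℤ) - (deg x).toAdd) ∧ |(deg x).toAdd| ≤ len x := by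
  obtain ⟨L, a, hL, rfl⟩ := exists_isReduced x
  rw [hL.len_prod_mul_of]
  have ha : deg (of a : HNNExtension G A B φ) = 1 := by simp [deg]
  rw [map_mul, ha, mul_one]
  induction L with
  | nil => simp
  | cons e L ih =>
    obtain ⟨⟨k, hk⟩, h2⟩ := ih hL.tail
    rw [abs_le] at h2 ⊢
    rw [List.prod_cons, map_mul, toAdd_mul, List.length_cons]
    push_cast
    rcases (hL.1 e (by simp)).deg_eq with h | h <;> rw [h]
    · exact ⟨⟨k, by omega⟩, by omega, by omega⟩
    · exact ⟨⟨k + 1, by omega⟩, by omega, by omega⟩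

variable (φ) in
/-- The length function of an HNN extension coming from its Bass–Serre tree. -/
noncomputable def treeLength : TreeLength (HNNExtension G A B φ) where
  len := len
  deg := deg
  len_one := len_one
  len_inv := len_inv
  four_point := len_four_point
  exists_split x n hx := by
    obtain ⟨L, a, hL, rfl⟩ := exists_isReduced x
    rw [hL.len_prod_mul_of] at hx
    match L, hL, hx with
    | e :: L, hL, hx =>
      refine ⟨e, L.prod * of a, by rw [List.prod_cons, mul_assoc], (hL.1 e (by simp)).len_eq, ?_⟩
      rw [hL.tail.len_prod_mul_of]
      simpa using hx
  parity x := (deg_parity_and_le x).1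
  deg_le x := (deg_parity_and_le x).2

lemma base_treeLength : (treeLength φ).base = (of : G →* HNNExtension G A B φ).range := by
  ext x; exact len_eq_zero_iff

lemma isEdge_iff {x : HNNExtension G A B φ} : (treeLength φ).len x = 1 ↔ IsEdge x :=
  ⟨isEdge_of_len_eq_one, IsEdge.len_eq⟩

lemma isEdge_t : IsEdge (t : HNNExtension G A B φ) := ⟨1, 1, 1, by simp⟩

lemma fixer_t : (treeLength φ).fixer t = B.map (of : G →* HNNExtension G A B φ) := by
  ext x
  rw [TreeLength.mem_fixer, ← TreeLength.mem_base, ← TreeLength.mem_base, base_treeLength]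
  constructor
  · rintro ⟨⟨g, rfl⟩, h⟩
    exact ⟨g, (mem_toSubgroup_of_mem_range (u := -1) (v := 1) (by simpa using h)).1, rfl⟩
  · rintro ⟨g, hg, rfl⟩
    exact ⟨⟨g, rfl⟩, ⟨φ.symm ⟨g, hg⟩, equiv_symm_eq_conj ⟨g, hg⟩⟩⟩

lemma card_fixer_of_mul (g : G) (x : HNNExtension G A B φ) :
    Nat.card ((treeLength φ).fixer (of g * x)) = Nat.card ((treeLength φ).fixer x) := by
  have hg : (treeLength φ).len (of g) = 0 := len_of (φ := φ) g
  have hg' : (treeLength φ).len (of g)⁻¹ = 0 := by rwa [TreeLength.len_inv]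
  have key : (treeLength φ).fixer (of g * x) =
      ((treeLength φ).fixer x).map (MulAut.conj (of g)).toMonoidHom := by
    ext y
    rw [Subgroup.mem_map_equiv, TreeLength.mem_fixer, TreeLength.mem_fixer, MulAut.conj_symm_apply,
      TreeLength.len_mul_of_len_right _ hg, TreeLength.len_mul_of_len_left _ hg']
    simp [mul_assoc]
  rw [key]
  exact Nat.card_congr (((treeLength φ).fixer x).equivMapOfInjective _
    (MulAut.conj (of g)).injective).symm.toEquiv

/-- All edges are translates of the one from 1 to t, up to orientation, whose stabilizer is the
image of B ≅ A. -/
lemma card_fixer_of_isEdge {x : HNNExtension G A B φ} (hx : IsEdge x) :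
    Nat.card ((treeLength φ).fixer x) = Nat.card A := by
  obtain ⟨a, b, u, rfl⟩ := hx
  rw [TreeLength.fixer_mul_of_mem_base _ (len_of (φ := φ) b : of b ∈ (treeLength φ).base),
    card_fixer_of_mul]
  have ht : Nat.card ((treeLength φ).fixer t) = Nat.card A := by
    rw [fixer_t, Nat.card_congr φ.toEquiv]
    exact Nat.card_congr (B.equivMapOfInjective of (of_injective φ)).symm.toEquiv
  rcases Int.units_eq_one_or u with rfl | rfl
  · simpa using ht
  · simpa using (TreeLength.card_fixer_inv (T := treeLength φ) t).trans ht

lemma closure_of_union_t :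
    Subgroup.closure (((of : G →* HNNExtension G A B φ).range : Set (HNNExtension G A B φ)) ∪ {t}) = ⊤ := by
  rw [Subgroup.eq_top_iff']
  intro x
  induction x using induction_on with
  | of g => exact Subgroup.subset_closure (Or.inl ⟨g, rfl⟩)
  | t => exact Subgroup.subset_closure (Or.inr rfl)
  | mul x y hx hy => exact mul_mem hx hy
  | inv x hx => exact inv_mem hx

end HNNExtension

/-! ### Normalizing isomorphisms of HNN extensions. -/

namespace HNNExtension

variable {G : Type*} [Group G] {H K : Subgroup G}

/-- Two homomorphisms between HNN extensions that are mutually inverse on the base groups and on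
the stable letters. -/
lemma nonempty_mulEquiv {f f₁ : H ≃* K} (α : MulAut G) (s : HNNExtension G H K f₁)
    (s' : HNNExtension G H K f) (hs : ∀ h : H, s * of (α h) = of (α (f h)) * s)
    (hs' : ∀ h : H, s' * of (α⁻¹ (h : G)) = of (α⁻¹ (f₁ h : G)) * s')
    (h₁ : lift (of.comp (α⁻¹ : MulAut G).toMonoidHom) s' hs' s = t)
    (h₂ : lift (of.comp α.toMonoidHom) s hs s' = t) :
    Nonempty (HNNExtension G H K f ≃* HNNExtension G H K f₁) :=
  ⟨MonoidHom.toMulEquiv (lift (of.comp α.toMonoidHom) s hs)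
    (lift (of.comp (α⁻¹ : MulAut G).toMonoidHom) s' hs')
    (hom_ext (by ext; simp) (by simpa using h₁))
    (hom_ext (by ext; simp) (by simpa using h₂))⟩

lemma finite_fixer_of_isEdge [Finite H] {f : H ≃* K} {x : HNNExtension G H K f}
    (hx : IsEdge x) : Finite ((treeLength f).fixer x) := by
  apply Nat.finite_of_card_ne_zero
  rw [card_fixer_of_isEdge hx]
  exact Nat.card_pos.ne'

/-- An OE-group embedded in an HNN extension with finite associated subgroups lies in a conjugate
of the base group. -/
lemma exists_conj_mem_range [Finite H] (hG : HNNIso.IsOEGroup G) (f : H ≃* K)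
    (j : G →* HNNExtension G H K f) (hj : Function.Injective j) :
    ∃ x, ∀ g, x⁻¹ * j g * x ∈ (of : G →* HNNExtension G H K f).range := by
  obtain ⟨S, hS, hends⟩ := hG.ends_lt_two
  have hell : ∀ g, (treeLength f).IsElliptic (j g) := fun g => by_contra fun hg =>
    absurd hends (not_lt.2 ((treeLength f).two_le_encard_end_of_not_isElliptic hS j hj
      (fun u hu => @Set.toFinite _ _ (finite_fixer_of_isEdge (isEdge_iff.1 hu))) hg))
  have hfg : j.range.FG := by
    have := hG.fg
    rw [← Group.fg_iff_subgroup_fg]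
    infer_instance
  obtain ⟨x, hx⟩ := (treeLength f).exists_forall_len_conj_eq_zero hfg (by
    rintro _ ⟨g, rfl⟩
    exact hell g)
  exact ⟨x, fun g => len_eq_zero_iff.1 (hx _ ⟨g, rfl⟩)⟩

/-- An isomorphism of HNN extensions of an OE-group can be conjugated so as to preserve the
base groups. -/
lemma exists_mulEquiv_map_range [Finite H] (hG : HNNIso.IsOEGroup G) {f f₁ : H ≃* K}
    (Φ : HNNExtension G H K f ≃* HNNExtension G H K f₁) :
    ∃ Ψ : HNNExtension G H K f ≃* HNNExtension G H K f₁,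
      (of : G →* HNNExtension G H K f).range.map Ψ.toMonoidHom = of.range := by
  obtain ⟨x, hx⟩ := exists_conj_mem_range hG f₁ (Φ.toMonoidHom.comp of)
    (Φ.injective.comp (of_injective f))
  obtain ⟨y, hy⟩ := exists_conj_mem_range hG f (Φ.symm.toMonoidHom.comp of)
    (Φ.symm.injective.comp (of_injective f₁))
  let Ψ : HNNExtension G H K f ≃* HNNExtension G H K f₁ := Φ.trans (MulAut.conj (Φ y))
  have hΨ : ∀ g, Ψ g = Φ y * Φ g * (Φ y)⁻¹ := fun g => by simp [Ψ]
  -- With Φ conjugated by Φ(y), the image of the base group contains the target base group, and it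
  -- lies in the conjugate of that group by z = Φ(y)x.
  have hle : (of : G →* HNNExtension G H K f₁).range ≤
      (of : G →* HNNExtension G H K f).range.map Ψ.toMonoidHom := by
    rintro _ ⟨g, rfl⟩
    refine ⟨_, hy g, ?_⟩
    change Ψ (y⁻¹ * Φ.symm (of g) * y) = of g
    rw [hΨ, map_mul, map_mul, Φ.apply_symm_apply, map_inv]
    group
  have hconj : ∀ g : G, (Φ y * x)⁻¹ * Ψ (of g) * (Φ y * x) ∈
      (of : G →* HNNExtension G H K f₁).range := fun g => by
    rw [hΨ]
    simpa [mul_assoc] using hx g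
  refine ⟨Ψ, ?_⟩
  set z := Φ y * x
  by_cases hz : z ∈ (of : G →* HNNExtension G H K f₁).range
  · refine le_antisymm ?_ hle
    rintro _ ⟨_, ⟨g, rfl⟩, rfl⟩
    have := mul_mem (mul_mem hz (hconj g)) (inv_mem hz)
    simpa [mul_assoc] using this
  -- If z moves the base vertex, the target base group fixes an edge, so everything is finite and
  -- equality follows by counting.
  · have hz0 : 0 < (treeLength f₁).len z :=
      Nat.pos_of_ne_zero fun h => hz (len_eq_zero_iff.1 h)
    obtain ⟨u, hu, hus⟩ := (treeLength f₁).exists_first_edge hz0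
    have hfix : (of : G →* HNNExtension G H K f₁).range ≤ (treeLength f₁).fixer u := by
      have h1 : (treeLength f₁).fixer z ≤ (treeLength f₁).fixer u := by
        have h2 := hus.len_eq hu
        conv_lhs => rw [← mul_inv_cancel_left u z]
        exact TreeLength.fixer_le_of_len_mul (by rwa [mul_inv_cancel_left])
      refine le_trans (fun r hr => ?_) h1
      rw [TreeLength.mem_fixer]
      refine ⟨len_eq_zero_iff.2 hr, len_eq_zero_iff.2 ?_⟩
      obtain ⟨_, ⟨g, rfl⟩, rfl⟩ := hle hr
      exact hconj g
    have := finite_fixer_of_isEdge (isEdge_iff.1 hu)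
    have : Finite (of : G →* HNNExtension G H K f₁).range :=
      Finite.of_injective _ (Subgroup.inclusion_injective hfix)
    have : Finite G := Finite.of_equiv _
      (MonoidHom.ofInjective (of_injective f₁)).symm.toEquiv
    have : Finite ((of : G →* HNNExtension G H K f).range.map Ψ.toMonoidHom) :=
      Finite.of_equiv _ ((MonoidHom.ofInjective (of_injective f)).trans
        ((of : G →* HNNExtension G H K f).range.equivMapOfInjective Ψ.toMonoidHom
          Ψ.injective)).toEquiv
    refine (Subgroup.eq_of_le_of_card_ge hle (le_of_eq ?_)).symm
    exact Nat.card_congr ((((MonoidHom.ofInjective (of_injective f)).trans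
        ((of : G →* HNNExtension G H K f).range.equivMapOfInjective Ψ.toMonoidHom
          Ψ.injective)).symm.trans (MonoidHom.ofInjective (of_injective f₁))).toEquiv)

/-- An isomorphism of HNN extensions that preserves the base groups maps the stable letter
to an edge. -/
lemma isEdge_map_t [Finite H] {f f₁ : H ≃* K}
    (Ψ : HNNExtension G H K f ≃* HNNExtension G H K f₁)
    (hΨ : (of : G →* HNNExtension G H K f).range.map Ψ.toMonoidHom = of.range) :
    IsEdge (Ψ t) := by
  have hmem : ∀ x, (treeLength f₁).len (Ψ x) = 0 ↔ (treeLength f).len x = 0 := by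
    intro x
    rw [← TreeLength.mem_base, ← TreeLength.mem_base, base_treeLength, base_treeLength, ← hΨ]
    exact Subgroup.mem_map_iff_mem (f := Ψ.toMonoidHom) Ψ.injective
  have hfix : ((treeLength f).fixer t).map Ψ.toMonoidHom = (treeLength f₁).fixer (Ψ t) := by
    ext y
    obtain ⟨x, rfl⟩ := Ψ.surjective y
    rw [show Ψ x = Ψ.toMonoidHom x from rfl, Subgroup.mem_map_iff_mem Ψ.injective,
      TreeLength.mem_fixer, TreeLength.mem_fixer]
    change _ ↔ (treeLength f₁).len (Ψ x) = 0 ∧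
      (treeLength f₁).len ((Ψ t)⁻¹ * Ψ x * Ψ t) = 0
    rw [← map_inv, ← map_mul, ← map_mul, hmem, hmem]
  rw [← isEdge_iff]
  refine TreeLength.len_eq_one_of_closure_eq_top (N := Nat.card H) (fun u hu =>
    ⟨finite_fixer_of_isEdge (isEdge_iff.1 hu), card_fixer_of_isEdge (isEdge_iff.1 hu)⟩)
    ?_ ?_ (isEdge_iff.2 isEdge_t)
  · rw [← hfix, ← card_fixer_of_isEdge (isEdge_t (φ := f))]
    exact Nat.card_congr (((treeLength f).fixer t).equivMapOfInjective Ψ.toMonoidHom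
      Ψ.injective).symm.toEquiv
  · have h := congrArg (Subgroup.map Ψ.toMonoidHom) (closure_of_union_t (φ := f))
    rw [MonoidHom.map_closure, Set.image_union, Set.image_singleton, ← Subgroup.coe_map, hΨ,
      Subgroup.map_top_of_surjective _ Ψ.surjective] at h
    rw [base_treeLength]
    exact h

end HNNExtension

/-! ### From isomorphisms to orbits and back. -/

namespace HNNIso

open HNNExtension

variable {G : Type*} [Group G] {H K : Subgroup G}

lemma smul_eq_of_forall_mem {φ : MulAut G} {H K : Subgroup G} [Finite K]
    (hc : Nat.card H = Nat.card K) (h : ∀ x ∈ H, φ x ∈ K) : φ • H = K := by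
  refine Subgroup.eq_of_le_of_card_ge ?_ ?_
  · rintro _ ⟨x, hx, rfl⟩
    exact h x hx
  · rw [← hc]
    exact (Nat.card_congr (Subgroup.equivSMul φ H).toEquiv).le

lemma mem_orbit_gammaBar_of_mem_gammaTilde {f f₁ : H ≃* K} {σ : Equiv.Perm (H ≃* K)}
    (hσ : σ ∈ GammaTilde H K) (h : σ f₁ = f) : f ∈ MulAction.orbit (GammaBar H K) f₁ := by
  refine ⟨⟨σ, ?_⟩, h⟩
  rw [GammaBar]
  split_ifs
  · exact Subgroup.mem_sup_left hσ
  · exact hσ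

/-- After normalization the isomorphism restricts to α on the base group and sends t to a t^u b.
Applying it to the relation t h t⁻¹ = f(h) and using Britton's lemma expresses f through f₁ or its
inverse, according to the sign u. -/
lemma mem_orbit_of_nonempty_mulEquiv [Finite H] [Finite K] (hG : IsOEGroup G) {f f₁ : H ≃* K}
    (h : Nonempty (HNNExtension G H K f ≃* HNNExtension G H K f₁)) :
    f ∈ MulAction.orbit (GammaBar H K) f₁ := by
  obtain ⟨Φ⟩ := h
  obtain ⟨Ψ, hΨ⟩ := exists_mulEquiv_map_range hG Φ
  have hedge := isEdge_map_t Ψ hΨ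
  obtain ⟨α, hα⟩ : ∃ α : MulAut G, ∀ g, Ψ (of g) = of (α g) := by
    let e := MonoidHom.ofInjective (of_injective f)
    let e₁ := MonoidHom.ofInjective (of_injective f₁)
    refine ⟨((e.trans ((of : G →* HNNExtension G H K f).range.equivMapOfInjective
      Ψ.toMonoidHom Ψ.injective)).trans (MulEquiv.subgroupCongr hΨ)).trans e₁.symm, fun g => ?_⟩
    have := MonoidHom.ofInjective_apply (of_injective f₁) (x := e₁.symm (((e.trans
      ((of : G →* HNNExtension G H K f).range.equivMapOfInjective
      Ψ.toMonoidHom Ψ.injective)).trans (MulEquiv.subgroupCongr hΨ)) g))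
    rw [MulEquiv.trans_apply, ← this]
    change _ = ((e₁ (e₁.symm _) : (of : G →* HNNExtension G H K f₁).range) :
      HNNExtension G H K f₁)
    rw [MulEquiv.apply_symm_apply]
    rfl
  obtain ⟨a, b, u, hs⟩ := hedge
  have hcard : Nat.card H = Nat.card K := Nat.card_congr f.toEquiv
  have hrel : ∀ h : H, (t ^ (u : ℤ) * of (b * α h * b⁻¹) * t ^ ((-u : ℤˣ) : ℤ) :
      HNNExtension G H K f₁) = of (a⁻¹ * α (f h) * a) := by
    intro h
    have h1 := congrArg Ψ (t_mul_of (φ := f) h)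
    rw [map_mul, map_mul, hα, hα, hs] at h1
    have h2 : of (α (f h)) = of a * t ^ (u : ℤ) * of b * of (α h) *
        (of a * t ^ (u : ℤ) * of b)⁻¹ := eq_mul_inv_of_mul_eq h1.symm
    rw [map_mul of _ a, map_mul of _ (α (f h)), h2]
    simp [mul_assoc]
  have hmem : ∀ h : H, b * α h * b⁻¹ ∈ toSubgroup H K u := fun h =>
    (mem_toSubgroup_of_mem_range (φ := f₁) ⟨_, (hrel h).symm⟩).1
  rcases Int.units_eq_one_or u with rfl | rfl
  · let β : MulAut G := MulAut.conj b * α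
    have hβ : ∀ x, β x = b * α x * b⁻¹ := fun x => by simp [β]
    have hβH : β • H = H := smul_eq_of_forall_mem rfl fun x hx => by
      rw [hβ]; exact hmem ⟨x, hx⟩
    have hf : ∀ h : H, (f₁ ⟨β h, by rw [hβ]; exact hmem h⟩ : G) = a⁻¹ * α (f h) * a := by
      intro h
      apply of_injective f₁
      rw [equiv_eq_conj, ← hrel h]
      simp [hβ]
    -- Chosen so that `tau G γ` undoes x ↦ a⁻¹α(x)a; since f₁(β(h)) = a⁻¹α(f(h))a, the action of γ
    -- takes f₁ to f.
    let γ : Holomorph G := ⟨β⁻¹ (b * a), β⁻¹⟩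
    have hγ : ∀ x, tau G γ (a⁻¹ * α x * a) = x := by
      intro x
      have : tau G γ (a⁻¹ * α x * a) = β⁻¹ (b * a * (a⁻¹ * α x * a) * (b * a)⁻¹) := by
        rw [tau_apply, map_mul β⁻¹ _ (b * a)⁻¹, map_mul β⁻¹ (b * a) (_ * _), map_inv]
      rw [this, show b * a * (a⁻¹ * α x * a) * (b * a)⁻¹ = β x by rw [hβ]; group]
      simp
    have hγK : tau G γ • K = K := smul_eq_of_forall_mem rfl fun x hx => by
      obtain ⟨y, hy⟩ := f₁.surjective ⟨x, hx⟩
      obtain ⟨h, rfl⟩ : ∃ h : H, (⟨β h, by rw [hβ]; exact hmem h⟩ : H) = y := by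
        have hy' : (y : G) ∈ β • H := hβH.symm ▸ y.2
        obtain ⟨h, hh, hhy⟩ := hy'
        exact ⟨⟨h, hh⟩, Subtype.ext hhy⟩
      have h1 := hf h
      rw [hy] at h1
      change x = _ at h1
      rw [h1, hγ]
      exact (f h).2
    have hγH : γ.right • H = H := by
      change β⁻¹ • H = H
      rw [inv_smul_eq_iff, hβH]
    refine mem_orbit_gammaBar_of_mem_gammaTilde (σ := actIso H K ⟨γ, hγH, hγK⟩) ⟨_, rfl⟩ ?_
    ext h
    change tau G γ (f₁ ((restrict γ.right hγH).symm h)) = _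
    have h1 : (restrict γ.right hγH).symm h = ⟨β h, by rw [hβ]; exact hmem h⟩ := by
      ext
      rw [coe_restrict_symm]
      simp [γ]
    rw [h1, hf, hγ]
  · let ψ : MulAut G := MulAut.conj b * α
    have hψ : ∀ x, ψ x = b * α x * b⁻¹ := fun x => by simp [ψ]
    have hf : ∀ h : H, (f₁.symm ⟨ψ h, by rw [hψ]; exact hmem h⟩ : G) = a⁻¹ * α (f h) * a := by
      intro h
      apply of_injective f₁
      rw [equiv_symm_eq_conj, ← hrel h]
      simp [hψ]
    have hψf : ∀ x : G, ψ x = (b * a) * (a⁻¹ * α x * a) * (b * a)⁻¹ := fun x => by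
      rw [hψ]; group
    -- For u = -1 the map ψ carries H into K, and conjugating ψ(K) by (ba)⁻¹ lands in H. Equal
    -- finite orders turn these inclusions into equalities.
    have hswap : IsSwap H K ψ (b * a)⁻¹ := by
      refine ⟨smul_eq_of_forall_mem hcard fun x hx => by rw [hψ]; exact hmem ⟨x, hx⟩, ?_⟩
      rw [← inv_smul_eq_iff, ← mul_smul, inv_inv]
      refine smul_eq_of_forall_mem hcard.symm fun x hx => ?_
      obtain ⟨h, hh⟩ := f.surjective ⟨x, hx⟩
      have h1 := hf h
      rw [hh] at h1
      have h2 : ((MulAut.conj (b * a))⁻¹ * ψ) x = a⁻¹ * α x * a := by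
        rw [MulAut.mul_apply, hψf, ← map_inv, MulAut.conj_apply]; group
      rw [h2, ← h1]
      exact SetLike.coe_mem _
    refine ⟨⟨iota hswap, ?_⟩, ?_⟩
    · rw [GammaBar_eq_of_isSwap hswap]
      exact Subgroup.mem_sup_right (Subgroup.mem_zpowers _)
    · ext h
      change (MulAut.conj (ψ⁻¹ (b * a)⁻¹⁻¹) * ψ⁻¹) (f₁.symm (restrict ψ hswap.map_H h)) = _
      have h1 : restrict ψ hswap.map_H h = ⟨ψ h, by rw [hψ]; exact hmem h⟩ := rfl
      rw [h1, hf, inv_inv, MulAut.mul_apply, MulAut.conj_apply, ← map_inv, ← map_mul, ← map_mul,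
        ← hψf]
      simp

/-- For γ = (g, α), extend α by t ↦ g⁻¹t; the inverse extends α⁻¹ by t ↦ α⁻¹(g)t. -/
lemma nonempty_mulEquiv_actIso (γ : GammaHK H K) (f : H ≃* K) :
    Nonempty (HNNExtension G H K f ≃* HNNExtension G H K (actIso H K γ f)) := by
  set α := γ.1.right with hα
  set g := γ.1.left with hg
  have hαH : ∀ h : H, α h ∈ H := fun h => (restrict α (map_left γ) h).2
  have hαH' : ∀ h : H, α⁻¹ h ∈ H := fun h => by
    have h1 := ((restrict α (map_left γ)).symm h).2
    rwa [coe_restrict_symm] at h1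
  have hf' : ∀ h : H, (actIso H K γ f h : G) = g * α (f ⟨α⁻¹ h, hαH' h⟩) * g⁻¹ := by
    intro h
    change tau G γ.1 (f ((restrict α (map_left γ)).symm h)) = _
    rw [tau_apply, show (restrict α (map_left γ)).symm h = ⟨α⁻¹ h, hαH' h⟩ from
      Subtype.ext (coe_restrict_symm _ _ _)]
  have hf'' : ∀ h : H, (actIso H K γ f ⟨α h, hαH h⟩ : G) = g * α (f h) * g⁻¹ := by
    intro h
    rw [hf']
    congr 4
    ext
    simp
  refine nonempty_mulEquiv α (of g⁻¹ * t) (of (α⁻¹ g) * t) (fun h => ?_) (fun h => ?_) ?_ ?_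
  · have h1 := t_mul_of (φ := actIso H K γ f) ⟨α h, hαH h⟩
    rw [hf''] at h1
    rw [mul_assoc]
    change _ * (t * of (α h)) = _
    rw [show of (α h) = of ((⟨α h, hαH h⟩ : H) : G) from rfl, h1]
    simp [mul_assoc]
  · have h1 := t_mul_of (φ := f) ⟨α⁻¹ h, hαH' h⟩
    rw [mul_assoc]
    change _ * (t * of (α⁻¹ h)) = _
    rw [show of (α⁻¹ h) = of ((⟨α⁻¹ h, hαH' h⟩ : H) : G) from rfl, h1, hf']
    simp [mul_assoc]
  · simp
  · simp

/-- Extend ψ by t ↦ g⁻¹t⁻¹: exchanging the associated subgroups reverses the stable letter. -/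
lemma nonempty_mulEquiv_iota {ψ : MulAut G} {g : G} (hs : IsSwap H K ψ g) (f : H ≃* K) :
    Nonempty (HNNExtension G H K (iota hs f) ≃* HNNExtension G H K f) := by
  have hψH : ∀ h : H, ψ h ∈ K := fun h => (restrict ψ hs.map_H h).2
  have hf' : ∀ h : H, (iota hs f h : G) = ψ⁻¹ (g⁻¹ * f.symm ⟨ψ h, hψH h⟩ * g) := by
    intro h
    change (MulAut.conj (ψ⁻¹ g⁻¹) * ψ⁻¹) (f.symm (restrict ψ hs.map_H h)) = _
    rw [show restrict ψ hs.map_H h = ⟨ψ h, hψH h⟩ from rfl]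
    simp
  have hK : ∀ h : H, ψ⁻¹ (f h : G) ∈ H := fun h => by
    have h1 := ((restrict ψ hs.map_H).symm (f h)).2
    rwa [coe_restrict_symm] at h1
  refine nonempty_mulEquiv ψ (of g⁻¹ * t⁻¹) (t⁻¹ * of (ψ⁻¹ g⁻¹)) (fun h => ?_) (fun h => ?_)
    ?_ ?_
  · rw [hf', mul_assoc, show of (ψ h) = of ((⟨ψ h, hψH h⟩ : K) : G) from rfl, inv_t_mul_of]
    simp [mul_assoc]
  · have h1 := of_mul_inv_t (φ := iota hs f) ⟨ψ⁻¹ (f h), hK h⟩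
    have h2 : f.symm ⟨ψ (ψ⁻¹ (f h)), hψH ⟨_, hK h⟩⟩ = h := by
      rw [MulEquiv.symm_apply_eq]
      ext
      simp
    rw [hf', h2] at h1
    change of (ψ⁻¹ (f h)) * t⁻¹ = _ at h1
    rw [← mul_assoc, h1]
    simp [mul_assoc]
  · simp
  · simp

lemma nonempty_mulEquiv_of_mem_gammaBar {σ : Equiv.Perm (H ≃* K)} (hσ : σ ∈ GammaBar H K)
    (f : H ≃* K) : Nonempty (HNNExtension G H K (σ f) ≃* HNNExtension G H K f) := by
  -- The permutations that preserve every isomorphism class form a subgroup, so only generators need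
  -- checking.
  let Θ : Subgroup (Equiv.Perm (H ≃* K)) :=
    { carrier := {σ | ∀ f, Nonempty (HNNExtension G H K (σ f) ≃* HNNExtension G H K f)}
      one_mem' := fun f => ⟨MulEquiv.refl _⟩
      mul_mem' := fun {a b} ha hb f => ⟨(ha (b f)).some.trans (hb f).some⟩
      inv_mem' := fun {a} ha f => by
        have := ha (a⁻¹ f)
        rw [← Equiv.Perm.mul_apply, mul_inv_cancel, Equiv.Perm.one_apply] at this
        exact ⟨this.some.symm⟩ }
  suffices GammaBar H K ≤ Θ from this hσ f
  have h1 : GammaTilde H K ≤ Θ := by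
    rintro _ ⟨γ, rfl⟩ f
    exact ⟨(nonempty_mulEquiv_actIso γ f).some.symm⟩
  rw [GammaBar]
  split_ifs with h
  · exact sup_le h1 ((Subgroup.zpowers_le).2 (nonempty_mulEquiv_iota h.choose_spec))
  · exact h1

universe u in
lemma isoClass_eq_iff {X Y : Type u} [Group X] [Group Y] :
    isoClass X = isoClass Y ↔ Nonempty (X ≃* Y) := by
  rw [isoClass, isoClass, Quotient.eq]
  constructor
  · rintro ⟨e⟩
    exact ⟨e.groupIsoToMulEquiv⟩
  · rintro ⟨e⟩
    exact ⟨e.toGrpIso⟩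

end HNNIso

theorem mainTheorem1 {G₁ : Type*} [Group G₁] (hG₁ : HNNIso.IsOEGroup G₁)
    (H K : Subgroup G₁) [Finite H] [Finite K] :
    (∀ f f₁ : H ≃* K,
      Nonempty (HNNExtension G₁ H K f ≃* HNNExtension G₁ H K f₁) ↔
        f ∈ MulAction.orbit (HNNIso.GammaBar H K) f₁) ∧
    (Set.range fun f : H ≃* K => HNNIso.isoClass (HNNExtension G₁ H K f)).encard =
      ENat.card (MulAction.orbitRel.Quotient (HNNIso.GammaBar H K) (H ≃* K)) := by
  have key : ∀ f f₁ : H ≃* K,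
      Nonempty (HNNExtension G₁ H K f ≃* HNNExtension G₁ H K f₁) ↔
        f ∈ MulAction.orbit (HNNIso.GammaBar H K) f₁ := by
    refine fun f f₁ => ⟨HNNIso.mem_orbit_of_nonempty_mulEquiv hG₁, ?_⟩
    rintro ⟨σ, rfl⟩
    exact HNNIso.nonempty_mulEquiv_of_mem_gammaBar σ.2 f₁
  refine ⟨key, ?_⟩
  let F : MulAction.orbitRel.Quotient (HNNIso.GammaBar H K) (H ≃* K) →
      Set.range fun f : H ≃* K => HNNIso.isoClass (HNNExtension G₁ H K f) :=
    Quotient.lift (fun f => ⟨HNNIso.isoClass (HNNExtension G₁ H K f), f, rfl⟩)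
      fun f f₁ h => Subtype.ext (HNNIso.isoClass_eq_iff.2 ((key f f₁).2 h))
  have hF : Function.Bijective F := by
    constructor
    · intro p q
      induction p using Quotient.inductionOn
      induction q using Quotient.inductionOn
      intro h
      exact Quotient.sound ((key _ _).1 (HNNIso.isoClass_eq_iff.1 (Subtype.ext_iff.1 h)))
    · rintro ⟨_, f, rfl⟩
      exact ⟨Quotient.mk _ f, rfl⟩
  exact (ENat.card_congr (Equiv.ofBijective F hF)).symm
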